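/- \textbf{Windmill construction.} Take three disjoint copies $G_0,G_1,G_2$ of a cubic graph and in each $G_i$ an edge $x_iy_i$. Let $x_i^0,x_i^1$ be the neighbours of $x_i$ other than $y_i$, and $y_i^0,y_i^1$ the neighbours of $y_i$ other than $x_i$, in any order. Delete $x_i,y_i$ from $G_i$ for $i=0,1,2$, and add ten new vertices $u,a_i,b_i,c_i$ $(i\in\{0,1,2\})$ such that, with indices modulo $3$, $a_i$ is adjacent to $x_{i+1}^0$ and $y_{i-1}^0$, $b_i$ is adjacent to $x_{i+1}^1$ and $y_{i-1}^1$, and $c_i$ is adjacent to $a_i$, $b_i$ and $u$. A \emph{cycle} of a graph is a connected subgraph with all degrees even; a \emph{cycle cover} is a finite family of cycles such that each edge of the graph is in at least one of them, and its \emph{length} is the sum of the numbers of edges of its cycles. A \emph{snark} is a finite connected cubic graph that is cyclically 4-edge-connected, has girth at least five, and is not 3-edge-colorable. \textbf{Theorem.} Let $\mathring{H}$ be a graph obtained by the windmill construction from three copies of the Petersen graph (it has $34$ vertices, among them $u,a_j,b_j,c_j$). Let $G$ be obtained by the windmill construction from three copies of $\mathring{H}$, where each deleted edge $x_iy_i$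 joins a vertex $c_j$ of $\mathring{H}$ to $a_j$ or $b_j$, and the three copies do not all have the same orientation, that is, at least one $x_i$ and at least one $y_i$ is a vertex $c_j$ of its copy of $\mathring{H}$. Then $G$ is a snark with $106$ vertices, and every cycle cover of $G$ has length at least $\tfrac43|E(G)|+2$. -/

import Mathlib

/-- The Petersen graph: an outer 5-cycle `(false, i)`, an inner pentagram `(true, i)`, and spokes. -/
def petersenGraph : SimpleGraph (Bool × Fin 5) :=
  SimpleGraph.fromRel fun p q =>
    (p.1 = false ∧ q.1 = false ∧ q.2 = p.2 + 1) ∨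
    (p.1 = true ∧ q.1 = true ∧ q.2 = p.2 + 2) ∨
    (p.1 = false ∧ q.1 = true ∧ q.2 = p.2)

/-- The choices made in the windmill construction from three copies `G_0, G_1, G_2` of a cubic
graph `G`: an edge `x_i y_i` in the `i`-th copy, an enumeration `x_i^0, x_i^1` of the neighbours of
`x_i` other than `y_i`, and an enumeration `y_i^0, y_i^1` of the neighbours of `y_i` other than
`x_i`. -/
structure WindmillData {V : Type*} (G : SimpleGraph V) where
  x : Fin 3 → V
  y : Fin 3 → V
  nx : Fin 3 → Fin 2 → V
  ny : Fin 3 → Fin 2 → V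
  adj : ∀ i, G.Adj (x i) (y i)
  nx_injective : ∀ i, Function.Injective (nx i)
  ny_injective : ∀ i, Function.Injective (ny i)
  range_nx : ∀ i, Set.range (nx i) = G.neighborSet (x i) \ {y i}
  range_ny : ∀ i, Set.range (ny i) = G.neighborSet (y i) \ {x i}

namespace WindmillData

variable {V : Type*} {G : SimpleGraph V}

/-- The vertices of the windmill graph: `old i v` is the vertex `v` of `H_i = G_i - {x_i, y_i}`;
the others are the ten new vertices. Indices are taken modulo 3. -/
inductive Vertex (D : WindmillData G) : Type _
  | old (i : Fin 3) (v : V) (hx : v ≠ D.x i) (hy : v ≠ D.y i)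
  | a (i : Fin 3)
  | b (i : Fin 3)
  | c (i : Fin 3)
  | u

/-- The edges of the windmill graph, each listed in at least one of its two directions. -/
def Rel (D : WindmillData G) : D.Vertex → D.Vertex → Prop
  | .old i v _ _, .old j w _ _ => i = j ∧ G.Adj v w
  | .a i, .old j v _ _ => (j = i + 1 ∧ v = D.nx j 0) ∨ (j = i - 1 ∧ v = D.ny j 0)
  | .b i, .old j v _ _ => (j = i + 1 ∧ v = D.nx j 1) ∨ (j = i - 1 ∧ v = D.ny j 1)
  | .c i, .a j => i = j
  | .c i, .b j => i = j
  | .c _, .u => True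
  | _, _ => False

/-- The graph produced by the windmill construction. -/
def graph (D : WindmillData G) : SimpleGraph D.Vertex := SimpleGraph.fromRel D.Rel

end WindmillData

/-- The set of edges of `G` with exactly one end in `X`. -/
def edgeCut {V : Type*} (G : SimpleGraph V) (X : Set V) : Set (Sym2 V) :=
  {e | ∃ v ∈ X, ∃ w ∉ X, G.Adj v w ∧ e = s(v, w)}

/-- Cyclically `k`-edge-connected: every edge-cut with a cycle on both sides has at least `k`
edges. -/
def IsCyclicallyEdgeConnected {V : Type*} (G : SimpleGraph V) (k : ℕ) : Prop :=
  ∀ X : Set V, ¬ (G.induce X).IsAcyclic → ¬ (G.induce Xᶜ).IsAcyclic → k ≤ (edgeCut G X).ncard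

/-- A snark: a finite connected cubic graph of girth at least five that is cyclically
4-edge-connected and not 3-edge-colorable. -/
structure IsSnark {V : Type*} (G : SimpleGraph V) : Prop where
  finite : Finite V
  connected : G.Connected
  cubic : ∀ v, (G.neighborSet v).ncard = 3
  girth : 5 ≤ G.egirth
  cyclicallyConnected : IsCyclicallyEdgeConnected G 4
  notColorable : ¬ G.lineGraph.Colorable 3

/-- A cycle: a connected subgraph with all degrees even. -/
def IsEvenCycle {V : Type*} {G : SimpleGraph V} (H : G.Subgraph) : Prop :=
  H.Connected ∧ ∀ v ∈ H.verts, Even (H.neighborSet v).ncard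

/-- A cycle cover: a finite family of cycles such that each edge is in at least one of them. -/
def IsCycleCover {V : Type*} (G : SimpleGraph V) (C : Multiset G.Subgraph) : Prop :=
  (∀ H ∈ C, IsEvenCycle H) ∧ ∀ e ∈ G.edgeSet, ∃ H ∈ C, e ∈ H.edgeSet

/-- The length of a cycle cover: the sum of the numbers of edges of its cycles. -/
noncomputable def coverLength {V : Type*} {G : SimpleGraph V} (C : Multiset G.Subgraph) : ℕ :=
  (C.map fun H => H.edgeSet.ncard).sum

/-! Number the cycles of a cover and label each edge by the set of indices of the cycles through it.
At a vertex of a cubic graph the three labels are nonempty and have empty symmetric difference, so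
their sizes have an even sum, at least 4. Summing over all vertices counts the length twice, and
4/3·|E| = 2|V|. Hence a cover of length at most 2|V| + 1 is tight (sizes 1, 1, 2) at all vertices
but at most one, and it remains to exclude such labellings (`IsCubic.le_coverLength`,
`not_tight_off_one_vertex`).

The Petersen graph has no tight labelling: the edges of size 2 would form a perfect matching whose
complement is two 5-cycles with singleton labels, and these do not fit together. Call a copy without
`x_i`, `y_i` a tile. By parity the two labels leaving it at `x_i` have the same symmetric difference
`R` as the two leaving at `y_i`. If the copy has no tight labelling, putting `R` on the deleted edge
cannot make both its ends tight, which restricts the sizes (`tile_sizes`). Arithmetic over three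
tiles then shows: tightness at all vertices except `c_j` and one of `a_j`, `b_j` forces size 1 on
the other edges at `c_j` and size 2 on the other edges at the second end (`hub_sizes`). In a tight
labelling three spokes of size 1 would thus meet at `u`, so the windmill graph has no tight
labelling either.

In the second windmill every tight tile is therefore oriented, with sizes 1, 1 at one end and 2, 2
at the other. As the orientations are mixed, one hub `{a, b, c}` receives two ends of size 2 and
another receives two ends of size 1; no single exceptional vertex repairs both.

A 3-edge-colouring would give a tight labelling, so none exists. The other snark properties pass
through the construction: absence of cycles of length 3 and 4, and the property that a cut of fewer
than four edges leaves at most one vertex on one side. -/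

open scoped symmDiff

/-! ### Edge labellings of cubic graphs. -/

/-- The vertex `v` has exactly the three distinct neighbours `p`, `q`, `r`. -/
def HasNeighbors {V : Type*} (G : SimpleGraph V) (v p q r : V) : Prop :=
  p ≠ q ∧ p ≠ r ∧ q ≠ r ∧ ∀ w, G.Adj v w ↔ w = p ∨ w = q ∨ w = r

/-- Every vertex has exactly three neighbours. -/
def IsCubic {V : Type*} (G : SimpleGraph V) : Prop :=
  ∀ v, ∃ p q r, HasNeighbors G v p q r

/-- At `v`, the labels of the three incident edges are nonempty and contain each colour an even
number of times. -/
def EvenAt {V : Type*} (G : SimpleGraph V) (ℓ : V → V → Finset ℕ) (v : V) : Prop :=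
  ∀ p q r, HasNeighbors G v p q r → (ℓ v p).Nonempty ∧ ℓ v p ∆ ℓ v q = ℓ v r

/-- The labels at `v` are even and have the least possible total size. -/
def TightAt {V : Type*} (G : SimpleGraph V) (ℓ : V → V → Finset ℕ) (v : V) : Prop :=
  EvenAt G ℓ v ∧
    ∀ p q r, HasNeighbors G v p q r → (ℓ v p).card + (ℓ v q).card + (ℓ v r).card = 4

/-- No edge labelling of `G` is tight at all vertices. -/
def NoTightLabeling {V : Type*} (G : SimpleGraph V) : Prop :=
  ∀ ℓ : V → V → Finset ℕ, (∀ v w, ℓ v w = ℓ w v) → ¬ ∀ v, TightAt G ℓ v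

section Basic

variable {V : Type*} {G : SimpleGraph V} {v p q r : V}

theorem HasNeighbors.rotate (h : HasNeighbors G v p q r) : HasNeighbors G v q r p := by
  obtain ⟨h1, h2, h3, h4⟩ := h
  exact ⟨h3, h1.symm, h2.symm, fun w => by rw [h4]; tauto⟩

theorem HasNeighbors.adj (h : HasNeighbors G v p q r) : G.Adj v p := (h.2.2.2 p).2 (Or.inl rfl)

/-- A property of the three neighbours that does not depend on their order can be transferred. -/
theorem HasNeighbors.transfer (h : HasNeighbors G v p q r) {Q : V → V → V → Prop}
    (hs : ∀ a b c, Q a b c → Q b a c) (hr : ∀ a b c, Q a b c → Q b c a) (hQ : Q p q r)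
    {p' q' r' : V} (h' : HasNeighbors G v p' q' r') : Q p' q' r' := by
  obtain ⟨h1, h2, h3, h4⟩ := h
  have e1 := (h4 p').1 h'.adj
  have e2 := (h4 q').1 h'.rotate.adj
  have e3 := (h4 r').1 h'.rotate.rotate.adj
  obtain ⟨k1, k2, k3, -⟩ := h'
  rcases e1 with rfl | rfl | rfl <;> rcases e2 with rfl | rfl | rfl <;>
    rcases e3 with rfl | rfl | rfl <;> first | contradiction | skip
  · exact hQ
  · exact hs _ _ _ (hr _ _ _ (hr _ _ _ hQ))
  · exact hs _ _ _ hQ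
  · exact hr _ _ _ hQ
  · exact hr _ _ _ (hr _ _ _ hQ)
  · exact hs _ _ _ (hr _ _ _ hQ)

theorem HasNeighbors.sum [Fintype V] [DecidableRel G.Adj] {M : Type*} [AddCommMonoid M]
    (h : HasNeighbors G v p q r) (f : V → M) :
    ∑ w, (if G.Adj v w then f w else 0) = f p + f q + f r := by
  classical
  obtain ⟨h1, h2, h3, h4⟩ := h
  have : (Finset.univ.filter fun w => G.Adj v w) = {p, q, r} := by
    ext w; simp [h4]
  rw [← Finset.sum_filter, this, Finset.sum_insert (by simp [h1, h2]),
    Finset.sum_insert (by simp [h3]), Finset.sum_singleton, add_assoc]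

theorem HasNeighbors.neighborSet_eq (h : HasNeighbors G v p q r) :
    G.neighborSet v = {p, q, r} := by
  ext w; simp [h.2.2.2]

theorem HasNeighbors.ncard (h : HasNeighbors G v p q r) : (G.neighborSet v).ncard = 3 := by
  rw [h.neighborSet_eq]
  exact Set.ncard_eq_three.2 ⟨p, q, r, h.1, h.2.1, h.2.2.1, rfl⟩

variable {ℓ : V → V → Finset ℕ}

theorem HasNeighbors.evenAt (h : HasNeighbors G v p q r) (hp : (ℓ v p).Nonempty)
    (hq : (ℓ v q).Nonempty) (hr : (ℓ v r).Nonempty) (e : ℓ v p ∆ ℓ v q = ℓ v r) :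
    EvenAt G ℓ v := by
  intro p' q' r' h'
  refine (h.transfer (Q := fun a b c => ((ℓ v a).Nonempty ∧ (ℓ v b).Nonempty ∧ (ℓ v c).Nonempty) ∧
    ℓ v a ∆ ℓ v b = ℓ v c) ?_ ?_ ⟨⟨hp, hq, hr⟩, e⟩ h').imp (fun h => h.1) id
  · rintro a b c ⟨⟨h1, h2, h3⟩, h4⟩
    exact ⟨⟨h2, h1, h3⟩, by rw [symmDiff_comm, h4]⟩
  · rintro a b c ⟨⟨h1, h2, h3⟩, h4⟩
    exact ⟨⟨h2, h3, h1⟩, by rw [← h4, symmDiff_comm (ℓ v a), symmDiff_symmDiff_cancel_left]⟩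

theorem HasNeighbors.tightAt (h : HasNeighbors G v p q r) (hp : (ℓ v p).Nonempty)
    (hq : (ℓ v q).Nonempty) (hr : (ℓ v r).Nonempty) (e : ℓ v p ∆ ℓ v q = ℓ v r)
    (hc : (ℓ v p).card + (ℓ v q).card + (ℓ v r).card = 4) : TightAt G ℓ v := by
  refine ⟨h.evenAt hp hq hr e, fun p' q' r' h' => h.transfer
    (Q := fun a b c => (ℓ v a).card + (ℓ v b).card + (ℓ v c).card = 4) ?_ ?_ hc h'⟩ <;>
  · intros; omega

theorem EvenAt.one_le (hv : EvenAt G ℓ v) (h : HasNeighbors G v p q r) :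
    1 ≤ (ℓ v p).card ∧ 1 ≤ (ℓ v q).card ∧ 1 ≤ (ℓ v r).card :=
  ⟨(hv _ _ _ h).1.card_pos, (hv _ _ _ h.rotate).1.card_pos, (hv _ _ _ h.rotate.rotate).1.card_pos⟩

end Basic

/-- The three sizes add up to twice the size of the union. -/
theorem Finset.card_symmDiff_triangle {α : Type*} [DecidableEq α] (A B : Finset α) :
    (∃ m, A.card + B.card + (A ∆ B).card = 2 * m) ∧ A.card ≤ B.card + (A ∆ B).card ∧
      B.card ≤ A.card + (A ∆ B).card ∧ (A ∆ B).card ≤ A.card + B.card := by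
  have h1 : (A ∆ B).card = (A \ B).card + (B \ A).card :=
    Finset.card_union_of_disjoint disjoint_sdiff_sdiff
  have h2 := Finset.card_sdiff_add_card_inter A B
  have h3 := Finset.card_sdiff_add_card_inter B A
  rw [Finset.inter_comm] at h3
  exact ⟨⟨(A \ B).card + (B \ A).card + (A ∩ B).card, by omega⟩, by omega, by omega, by omega⟩

/-! ### The Petersen graph has no tight labelling. -/

/-- Here `p` and `q` are the colours along the two 5-cycles of singleton labels, and both sides of
`h` are the label of a spoke. -/
theorem petersen_core (p q : Fin 5 → ℕ) (hp : ∀ i, p (i - 1) ≠ p i)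
    (h : ∀ i, ({p (i - 1), p i} : Finset ℕ) = {q (i - 2), q i}) : False := by
  have key : ∀ i, (p (i - 1) = q (i - 2) ∧ p i = q i) ∨ (p (i - 1) = q i ∧ p i = q (i - 2)) := by
    intro i
    have h1 : p (i - 1) ∈ ({q (i - 2), q i} : Finset ℕ) := by rw [← h]; simp
    have h2 : p i ∈ ({q (i - 2), q i} : Finset ℕ) := by rw [← h]; simp
    have h3 := hp i
    simp only [Finset.mem_insert, Finset.mem_singleton] at h1 h2
    grind
  have k0 : (p 4 = q 3 ∧ p 0 = q 0) ∨ (p 4 = q 0 ∧ p 0 = q 3) := key 0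
  have k1 : (p 0 = q 4 ∧ p 1 = q 1) ∨ (p 0 = q 1 ∧ p 1 = q 4) := key 1
  have k2 : (p 1 = q 0 ∧ p 2 = q 2) ∨ (p 1 = q 2 ∧ p 2 = q 0) := key 2
  have k3 : (p 2 = q 1 ∧ p 3 = q 3) ∨ (p 2 = q 3 ∧ p 3 = q 1) := key 3
  have k4 : (p 3 = q 2 ∧ p 4 = q 4) ∨ (p 3 = q 4 ∧ p 4 = q 2) := key 4
  have n0 : p 4 ≠ p 0 := hp 0
  have n1 : p 0 ≠ p 1 := hp 1
  have n2 : p 1 ≠ p 2 := hp 2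
  have n3 : p 2 ≠ p 3 := hp 3
  have n4 : p 3 ≠ p 4 := hp 4
  -- Each spoke matches its two pairs in parallel or crosswise; all 32 patterns force two
  -- consecutive values of `p` to agree.
  rcases k0 with ⟨a, b⟩ | ⟨a, b⟩ <;> rcases k1 with ⟨c, d⟩ | ⟨c, d⟩ <;>
    rcases k2 with ⟨e, f⟩ | ⟨e, f⟩ <;> rcases k3 with ⟨g, k⟩ | ⟨g, k⟩ <;>
    rcases k4 with ⟨l, m⟩ | ⟨l, m⟩ <;> omega

theorem hasNeighbors_petersen_outer (i : Fin 5) :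
    HasNeighbors petersenGraph (false, i) (false, i - 1) (false, i + 1) (true, i) := by
  simp only [HasNeighbors, petersenGraph, SimpleGraph.fromRel_adj]
  revert i; decide

theorem hasNeighbors_petersen_inner (i : Fin 5) :
    HasNeighbors petersenGraph (true, i) (true, i - 2) (true, i + 2) (false, i) := by
  simp only [HasNeighbors, petersenGraph, SimpleGraph.fromRel_adj]
  revert i; decide

theorem petersen_isCubic : IsCubic petersenGraph
  | (false, i) => ⟨_, _, _, hasNeighbors_petersen_outer i⟩
  | (true, i) => ⟨_, _, _, hasNeighbors_petersen_inner i⟩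

/-- In a drawing of the Petersen graph as a pentagon, a pentagram and five spokes, the spokes cannot
all have labels of size two in a tight labelling. -/
theorem TightAt.petersen_spokes {V : Type*} {G : SimpleGraph V} {ℓ : V → V → Finset ℕ}
    (hs : ∀ v w, ℓ v w = ℓ w v) (ht : ∀ v, TightAt G ℓ v) (P Q : Fin 5 → V)
    (hP : ∀ i, HasNeighbors G (P i) (P (i - 1)) (P (i + 1)) (Q i))
    (hQ : ∀ i, HasNeighbors G (Q i) (Q (i - 2)) (Q (i + 2)) (P i))
    (h2 : ∀ i, 2 ≤ (ℓ (P i) (Q i)).card) : False := by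
  have h1 : ∀ i, (ℓ (P i) (P (i + 1))).card = 1 := fun i => by
    have := (ht _).2 _ _ _ (hP i)
    have := (ht _).1.one_le (hP i)
    have := h2 i
    omega
  have h1' : ∀ i, (ℓ (Q i) (Q (i + 2))).card = 1 := fun i => by
    have := (ht _).2 _ _ _ (hQ i)
    have := (ht _).1.one_le (hQ i)
    have := h2 i
    have := congrArg Finset.card (hs (P i) (Q i))
    omega
  choose p hp using fun i => Finset.card_eq_one.1 (h1 i)
  choose q hq using fun i => Finset.card_eq_one.1 (h1' i)
  have ep : ∀ i, ℓ (P i) (P (i - 1)) = {p (i - 1)} := fun i => by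
    rw [hs, ← hp, sub_add_cancel]
  have eq : ∀ i, ℓ (Q i) (Q (i - 2)) = {q (i - 2)} := fun i => by
    rw [hs, ← hq, sub_add_cancel]
  have sp : ∀ i, ({p (i - 1)} : Finset ℕ) ∆ {p i} = ℓ (P i) (Q i) := fun i => by
    rw [← ep, ← hp]; exact ((ht _).1 _ _ _ (hP i)).2
  have sq : ∀ i, ({q (i - 2)} : Finset ℕ) ∆ {q i} = ℓ (P i) (Q i) := fun i => by
    rw [← eq, ← hq, hs (P i)]; exact ((ht _).1 _ _ _ (hQ i)).2
  have pair : ∀ a b : ℕ, a ≠ b → ({a} : Finset ℕ) ∆ {b} = {a, b} := fun a b hab => by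
    ext x; simp only [Finset.mem_symmDiff, Finset.mem_singleton, Finset.mem_insert]
    constructor
    · tauto
    · rintro (rfl | rfl) <;> tauto
  have ne_of : ∀ a b i, ({a} : Finset ℕ) ∆ {b} = ℓ (P i) (Q i) → a ≠ b := by
    rintro a b i h rfl
    have := h2 i
    rw [← h, symmDiff_self] at this
    simp at this
  refine petersen_core p q (fun i => ne_of _ _ i (sp i)) fun i => ?_
  rw [← pair _ _ (ne_of _ _ i (sp i)), ← pair _ _ (ne_of _ _ i (sq i)), sp, sq]

/-- Sizes 1, 1, 2 at each vertex make the edges of size 2 a perfect matching. The Petersen graph has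
six of them: the five spokes, and for each spoke one matching that contains only this spoke. -/
theorem petersen_matching (o n s : Fin 5 → ℕ)
    (h1 : ∀ i, 1 ≤ o i ∧ 1 ≤ n i ∧ 1 ≤ s i)
    (ho : ∀ i, o (i - 1) + o i + s i = 4) (hn : ∀ i, n (i - 2) + n i + s i = 4) :
    (∀ i, 2 ≤ s i) ∨ ∃ i, 2 ≤ s i ∧ 2 ≤ o (i + 1) ∧ 2 ≤ o (i + 3) ∧ 2 ≤ n (i + 1) ∧
      2 ≤ n (i + 2) := by
  have a0 : o 4 + o 0 + s 0 = 4 := ho 0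
  have a1 : o 0 + o 1 + s 1 = 4 := ho 1
  have a2 : o 1 + o 2 + s 2 = 4 := ho 2
  have a3 : o 2 + o 3 + s 3 = 4 := ho 3
  have a4 : o 3 + o 4 + s 4 = 4 := ho 4
  have b0 : n 3 + n 0 + s 0 = 4 := hn 0
  have b1 : n 4 + n 1 + s 1 = 4 := hn 1
  have b2 : n 0 + n 2 + s 2 = 4 := hn 2
  have b3 : n 1 + n 3 + s 3 = 4 := hn 3
  have b4 : n 2 + n 4 + s 4 = 4 := hn 4
  have c0 := h1 0
  have c1 := h1 1
  have c2 := h1 2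
  have c3 := h1 3
  have c4 := h1 4
  clear h1 ho hn
  have key : (2 ≤ s 0 ∧ 2 ≤ s 1 ∧ 2 ≤ s 2 ∧ 2 ≤ s 3 ∧ 2 ≤ s 4) ∨
      (2 ≤ s 0 ∧ 2 ≤ o 1 ∧ 2 ≤ o 3 ∧ 2 ≤ n 1 ∧ 2 ≤ n 2) ∨
      (2 ≤ s 1 ∧ 2 ≤ o 2 ∧ 2 ≤ o 4 ∧ 2 ≤ n 2 ∧ 2 ≤ n 3) ∨
      (2 ≤ s 2 ∧ 2 ≤ o 3 ∧ 2 ≤ o 0 ∧ 2 ≤ n 3 ∧ 2 ≤ n 4) ∨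
      (2 ≤ s 3 ∧ 2 ≤ o 4 ∧ 2 ≤ o 1 ∧ 2 ≤ n 4 ∧ 2 ≤ n 0) ∨
      (2 ≤ s 4 ∧ 2 ≤ o 0 ∧ 2 ≤ o 2 ∧ 2 ≤ n 0 ∧ 2 ≤ n 1) := by
    rcases (by omega : s 0 = 1 ∨ s 0 = 2) with e0 | e0 <;>
    rcases (by omega : s 1 = 1 ∨ s 1 = 2) with e1 | e1 <;>
    rcases (by omega : s 2 = 1 ∨ s 2 = 2) with e2 | e2 <;>
    rcases (by omega : s 3 = 1 ∨ s 3 = 2) with e3 | e3 <;>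
    rcases (by omega : s 4 = 1 ∨ s 4 = 2) with e4 | e4 <;>
    simp only [e0, e1, e2, e3, e4] at a0 a1 a2 a3 a4 b0 b1 b2 b3 b4 ⊢ <;>
    first
    | (exfalso; omega)
    | exact Or.inl (by decide)
    | exact Or.inr (Or.inl ⟨by decide, by omega⟩)
    | exact Or.inr (Or.inr (Or.inl ⟨by decide, by omega⟩))
    | exact Or.inr (Or.inr (Or.inr (Or.inl ⟨by decide, by omega⟩)))
    | exact Or.inr (Or.inr (Or.inr (Or.inr (Or.inl ⟨by decide, by omega⟩))))
    | exact Or.inr (Or.inr (Or.inr (Or.inr (Or.inr ⟨by decide, by omega⟩))))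
  rcases key with h | h | h | h | h | h
  · left
    intro i
    fin_cases i
    exacts [h.1, h.2.1, h.2.2.1, h.2.2.2.1, h.2.2.2.2]
  exacts [Or.inr ⟨0, h⟩, Or.inr ⟨1, h⟩, Or.inr ⟨2, h⟩, Or.inr ⟨3, h⟩, Or.inr ⟨4, h⟩]

theorem petersen_noTightLabeling : NoTightLabeling petersenGraph := by
  intro ℓ hs ht
  have ho : ∀ i, _ := fun i => (ht _).2 _ _ _ (hasNeighbors_petersen_outer i)
  have hn : ∀ i, _ := fun i => (ht _).2 _ _ _ (hasNeighbors_petersen_inner i)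
  have ho1 : ∀ i, _ := fun i => (ht _).1.one_le (hasNeighbors_petersen_outer i)
  have hn1 : ∀ i, _ := fun i => (ht _).1.one_le (hasNeighbors_petersen_inner i)
  rcases petersen_matching (fun i => (ℓ (false, i) (false, i + 1)).card)
    (fun i => (ℓ (true, i) (true, i + 2)).card) (fun i => (ℓ (false, i) (true, i)).card)
    (fun i => ⟨(ho1 i).2.1, (hn1 i).2.1, (ho1 i).2.2⟩)
    (fun i => by have := ho i; simp only [sub_add_cancel, hs (false, i - 1)]; exact this)
    (fun i => by
      have := hn i; simp only [sub_add_cancel, hs (true, i - 2), hs (false, i)]; exact this) with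
    h | ⟨i, h0, h1, h2, h3, h4⟩
  · exact TightAt.petersen_spokes hs ht _ _ hasNeighbors_petersen_outer
      hasNeighbors_petersen_inner h
  -- Redraw the graph so that the second kind of matching becomes the set of spokes; its complement
  -- is again a pentagon and a pentagram.
  · refine TightAt.petersen_spokes hs ht
      ![(false, i), (false, i + 1), (true, i + 1), (true, i + 4), (false, i + 4)]
      ![(true, i), (false, i + 2), (true, i + 3), (true, i + 2), (false, i + 3)] ?_ ?_ ?_
    · simp only [HasNeighbors, petersenGraph, SimpleGraph.fromRel_adj]
      clear * -
      revert i; decide +kernel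
    · simp only [HasNeighbors, petersenGraph, SimpleGraph.fromRel_adj]
      clear * -
      revert i; decide +kernel
    · intro j
      simp only [add_assoc] at h1 h2 h3 h4
      rw [hs] at h2 h4
      fin_cases j
      · exact h0
      · exact h1
      · exact h3
      · exact h4
      · exact h2

/-! ### Adjacency in the windmill graph. -/

namespace WindmillData

variable {V : Type*} {G : SimpleGraph V} (D : WindmillData G)

theorem pred_ne_succ (i : Fin 3) : i - 1 ≠ i + 1 := by revert i; decide

theorem nx_mem (i k) : G.Adj (D.x i) (D.nx i k) ∧ D.nx i k ≠ D.y i := by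
  have : D.nx i k ∈ G.neighborSet (D.x i) \ {D.y i} := D.range_nx i ▸ Set.mem_range_self k
  simpa using this

theorem ny_mem (i k) : G.Adj (D.y i) (D.ny i k) ∧ D.ny i k ≠ D.x i := by
  have : D.ny i k ∈ G.neighborSet (D.y i) \ {D.x i} := D.range_ny i ▸ Set.mem_range_self k
  simpa using this

theorem nx_ne_x (i k) : D.nx i k ≠ D.x i := (D.nx_mem i k).1.ne'
theorem nx_ne_y (i k) : D.nx i k ≠ D.y i := (D.nx_mem i k).2
theorem ny_ne_y (i k) : D.ny i k ≠ D.y i := (D.ny_mem i k).1.ne'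
theorem ny_ne_x (i k) : D.ny i k ≠ D.x i := (D.ny_mem i k).2
theorem x_ne_y (i) : D.x i ≠ D.y i := (D.adj i).ne
theorem nx_ne (i) : D.nx i 0 ≠ D.nx i 1 := fun h => absurd (D.nx_injective i h) (by decide)
theorem ny_ne (i) : D.ny i 0 ≠ D.ny i 1 := fun h => absurd (D.ny_injective i h) (by decide)

theorem adj_x_iff (i) (w : V) : G.Adj (D.x i) w ↔ w = D.nx i 0 ∨ w = D.nx i 1 ∨ w = D.y i := by
  have h := Set.ext_iff.1 (D.range_nx i) w
  simp only [Set.mem_range, Fin.exists_fin_two, Set.mem_sdiff, SimpleGraph.mem_neighborSet,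
    Set.mem_singleton_iff] at h
  have := D.adj i
  constructor
  · intro hw
    by_cases hy : w = D.y i
    · exact Or.inr (Or.inr hy)
    · rcases h.2 ⟨hw, hy⟩ with h | h <;> simp [h]
  · rintro (rfl | rfl | rfl)
    exacts [(D.nx_mem i 0).1, (D.nx_mem i 1).1, this]

theorem adj_y_iff (i) (w : V) : G.Adj (D.y i) w ↔ w = D.ny i 0 ∨ w = D.ny i 1 ∨ w = D.x i := by
  have h := Set.ext_iff.1 (D.range_ny i) w
  simp only [Set.mem_range, Fin.exists_fin_two, Set.mem_sdiff, SimpleGraph.mem_neighborSet,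
    Set.mem_singleton_iff] at h
  have := (D.adj i).symm
  constructor
  · intro hw
    by_cases hy : w = D.x i
    · exact Or.inr (Or.inr hy)
    · rcases h.2 ⟨hw, hy⟩ with h | h <;> simp [h]
  · rintro (rfl | rfl | rfl)
    exacts [(D.ny_mem i 0).1, (D.ny_mem i 1).1, this]

theorem hasNeighbors_x (i) : HasNeighbors G (D.x i) (D.nx i 0) (D.nx i 1) (D.y i) :=
  ⟨D.nx_ne i, D.nx_ne_y i 0, D.nx_ne_y i 1, D.adj_x_iff i⟩

theorem hasNeighbors_y (i) : HasNeighbors G (D.y i) (D.ny i 0) (D.ny i 1) (D.x i) :=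
  ⟨D.ny_ne i, D.ny_ne_x i 0, D.ny_ne_x i 1, D.adj_y_iff i⟩

/-- The vertex `x_i^k` of the windmill graph. -/
def px (i : Fin 3) (k : Fin 2) : D.Vertex := .old i (D.nx i k) (D.nx_ne_x i k) (D.nx_ne_y i k)

/-- The vertex `y_i^k` of the windmill graph. -/
def py (i : Fin 3) (k : Fin 2) : D.Vertex := .old i (D.ny i k) (D.ny_ne_x i k) (D.ny_ne_y i k)

theorem hasNeighbors_u : HasNeighbors D.graph .u (.c 0) (.c 1) (.c 2) := by
  refine ⟨by simp, by simp, by simp, fun w => ?_⟩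
  cases w <;> simp [graph, SimpleGraph.fromRel_adj, Rel]
  rename_i i; revert i; decide

theorem hasNeighbors_c (i : Fin 3) : HasNeighbors D.graph (.c i) (.a i) (.b i) .u := by
  refine ⟨by simp, by simp, by simp, fun w => ?_⟩
  cases w <;> simp [graph, SimpleGraph.fromRel_adj, Rel, eq_comm]

theorem hasNeighbors_a (i : Fin 3) :
    HasNeighbors D.graph (.a i) (D.px (i + 1) 0) (D.py (i - 1) 0) (.c i) := by
  refine ⟨?_, by simp [px], by simp [py], fun w => ?_⟩
  · simp only [px, py, ne_eq, Vertex.old.injEq]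
    exact fun h => pred_ne_succ i h.1.symm
  · cases w <;> simp [graph, SimpleGraph.fromRel_adj, Rel, px, py, eq_comm]
    refine or_congr (and_congr_right ?_) (and_congr_right ?_) <;> rintro rfl <;> rfl

theorem hasNeighbors_b (i : Fin 3) :
    HasNeighbors D.graph (.b i) (D.px (i + 1) 1) (D.py (i - 1) 1) (.c i) := by
  refine ⟨?_, by simp [px], by simp [py], fun w => ?_⟩
  · simp only [px, py, ne_eq, Vertex.old.injEq]
    exact fun h => pred_ne_succ i h.1.symm
  · cases w <;> simp [graph, SimpleGraph.fromRel_adj, Rel, px, py, eq_comm]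
    refine or_congr (and_congr_right ?_) (and_congr_right ?_) <;> rintro rfl <;> rfl

open Classical in
/-- The end in the windmill graph of the edge that the edge `v w` of the `i`-th copy turns into,
seen from the remaining vertex `v`. -/
noncomputable def out (i : Fin 3) (v w : V) : D.Vertex :=
  if hx : w = D.x i then (if v = D.nx i 0 then .a (i - 1) else .b (i - 1))
  else if hy : w = D.y i then (if v = D.ny i 0 then .a (i + 1) else .b (i + 1))
  else .old i w hx hy

theorem out_old (i : Fin 3) (v : V) {w : V} (hx : w ≠ D.x i) (hy : w ≠ D.y i) :
    D.out i v w = .old i w hx hy := by simp [out, hx, hy]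

@[simp] theorem out_nx_zero (i : Fin 3) : D.out i (D.nx i 0) (D.x i) = .a (i - 1) := by simp [out]
@[simp] theorem out_nx_one (i : Fin 3) : D.out i (D.nx i 1) (D.x i) = .b (i - 1) := by
  simp [out, (D.nx_ne i).symm]
@[simp] theorem out_ny_zero (i : Fin 3) : D.out i (D.ny i 0) (D.y i) = .a (i + 1) := by
  simp [out, (D.x_ne_y i).symm]
@[simp] theorem out_ny_one (i : Fin 3) : D.out i (D.ny i 1) (D.y i) = .b (i + 1) := by
  simp [out, (D.x_ne_y i).symm, (D.ny_ne i).symm]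

theorem out_injective (i : Fin 3) (v : V) : Function.Injective (D.out i v) := by
  have h1 := pred_ne_succ i
  intro w w' h
  unfold out at h
  split_ifs at h <;> simp_all

/-- Edges at a tile vertex correspond to its edges in `G`: only an edge towards `x_i` or `y_i` is
redirected, to an `a` or `b` of a neighbouring hub. -/
theorem adj_old_iff (i : Fin 3) {v : V} (hx : v ≠ D.x i) (hy : v ≠ D.y i) (z : D.Vertex) :
    D.graph.Adj (.old i v hx hy) z ↔ ∃ w, G.Adj v w ∧ z = D.out i v w := by
  have h1 := pred_ne_succ i
  have ax : G.Adj v (D.x i) ↔ v = D.nx i 0 ∨ v = D.nx i 1 := by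
    rw [G.adj_comm, adj_x_iff]; tauto
  have ay : G.Adj v (D.y i) ↔ v = D.ny i 0 ∨ v = D.ny i 1 := by
    rw [G.adj_comm, adj_y_iff]; tauto
  have split : (∃ w, G.Adj v w ∧ z = D.out i v w) ↔
      (v = D.nx i 0 ∧ z = .a (i - 1)) ∨ (v = D.nx i 1 ∧ z = .b (i - 1)) ∨
      (v = D.ny i 0 ∧ z = .a (i + 1)) ∨ (v = D.ny i 1 ∧ z = .b (i + 1)) ∨
      ∃ (w : V) (hx : w ≠ D.x i) (hy : w ≠ D.y i), G.Adj v w ∧ z = .old i w hx hy := by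
    constructor
    · rintro ⟨w, hw, rfl⟩
      by_cases h : w = D.x i
      · subst h
        rcases ax.1 hw with rfl | rfl <;> simp
      by_cases h' : w = D.y i
      · subst h'
        rcases ay.1 hw with rfl | rfl <;> simp
      exact Or.inr (Or.inr (Or.inr (Or.inr ⟨w, h, h', hw, D.out_old i v h h'⟩)))
    · rintro (⟨rfl, rfl⟩ | ⟨rfl, rfl⟩ | ⟨rfl, rfl⟩ | ⟨rfl, rfl⟩ | ⟨w, h, h', hw, rfl⟩)
      · exact ⟨_, ax.2 (by simp), by simp⟩
      · exact ⟨_, ax.2 (by simp), by simp⟩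
      · exact ⟨_, ay.2 (by simp), by simp⟩
      · exact ⟨_, ay.2 (by simp), by simp⟩
      · exact ⟨w, hw, (D.out_old i v h h').symm⟩
  rw [split]
  have e1 : ∀ j : Fin 3, i = j + 1 ↔ j = i - 1 := fun j => by
    constructor <;> rintro rfl <;> simp
  have e2 : ∀ j : Fin 3, i = j - 1 ↔ j = i + 1 := fun j => by
    constructor <;> rintro rfl <;> simp
  cases z with
  | old j w hx' hy' =>
    simp only [graph, SimpleGraph.fromRel_adj, Rel, Vertex.old.injEq, ne_eq, reduceCtorEq, and_false, false_or]
    constructor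
    · rintro ⟨-, ⟨rfl, h⟩ | ⟨rfl, h⟩⟩
      exacts [⟨w, hx', hy', h, rfl, rfl⟩, ⟨w, hx', hy', h.symm, rfl, rfl⟩]
    · rintro ⟨w', h, h', hw, rfl, rfl⟩
      exact ⟨fun h => hw.ne h.2, Or.inl ⟨rfl, hw⟩⟩
  | a j =>
    simp only [graph, SimpleGraph.fromRel_adj, Rel, e1, e2, Vertex.a.injEq]
    simp; tauto
  | b j =>
    simp only [graph, SimpleGraph.fromRel_adj, Rel, e1, e2, Vertex.b.injEq]
    simp; tauto
  | c j => simp [graph, SimpleGraph.fromRel_adj, Rel]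
  | u => simp [graph, SimpleGraph.fromRel_adj, Rel]

theorem hasNeighbors_old (i : Fin 3) {v p q r : V} (hx : v ≠ D.x i) (hy : v ≠ D.y i)
    (h : HasNeighbors G v p q r) :
    HasNeighbors D.graph (.old i v hx hy) (D.out i v p) (D.out i v q) (D.out i v r) := by
  have inj := D.out_injective i v
  refine ⟨inj.ne h.1, inj.ne h.2.1, inj.ne h.2.2.1, fun w => ?_⟩
  rw [adj_old_iff]
  simp only [h.2.2.2]
  constructor
  · rintro ⟨w, rfl | rfl | rfl, rfl⟩ <;> simp
  · rintro (rfl | rfl | rfl)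
    exacts [⟨p, by simp⟩, ⟨q, by simp⟩, ⟨r, by simp⟩]

theorem graph_isCubic (hG : IsCubic G) : IsCubic D.graph
  | .old i v hx hy => by
    obtain ⟨p, q, r, h⟩ := hG v
    exact ⟨_, _, _, D.hasNeighbors_old i hx hy h⟩
  | .a i => ⟨_, _, _, D.hasNeighbors_a i⟩
  | .b i => ⟨_, _, _, D.hasNeighbors_b i⟩
  | .c i => ⟨_, _, _, D.hasNeighbors_c i⟩
  | .u => ⟨_, _, _, D.hasNeighbors_u⟩

end WindmillData

/-! ### Labels on the four edges leaving a tile. -/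

theorem sum_sum_eq_zero_of_symm {V : Type*} [Fintype V] (f : V → V → ZMod 2)
    (hs : ∀ v w, f v w = f w v) (h0 : ∀ v, f v v = 0) : ∑ v, ∑ w, f v w = 0 := by
  rw [← Fintype.sum_prod_type']
  refine Finset.sum_involution (fun p _ => p.swap) ?_ ?_ ?_ ?_
  · rintro ⟨v, w⟩ -
    simp only [Prod.swap_prod_mk, hs w v]
    exact CharTwo.add_self_eq_zero _
  · rintro ⟨v, w⟩ - h e
    simp only [Prod.swap_prod_mk, Prod.mk.injEq] at e
    rw [e.1] at h
    exact h (h0 _)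
  · simp
  · simp

/-- The sizes of the labels on the four edges leaving a tight tile, and of the symmetric difference
of the labels in either pair. -/
def TileSizes (x₀ x₁ y₀ y₁ r : ℕ) : Prop :=
  (1 ≤ x₀ ∧ x₀ ≤ 2 ∧ 1 ≤ y₀ ∧ y₀ ≤ 2) ∧
  ((x₀ = x₁ ∧ y₀ = y₁ ∧ (r = 0 ∨ (r = 2 ∧ (x₀ = 2 ∨ y₀ = 2)) ∨ (r = 4 ∧ x₀ = 2 ∧ y₀ = 2))) ∨
    (r = 3 ∧ x₀ + x₁ = 3 ∧ y₀ + y₁ = 3))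

namespace WindmillData

variable {V : Type*} {G : SimpleGraph V} (D : WindmillData G)

open Classical in
/-- The labelling of the `i`-th copy of `G` obtained from a labelling of the windmill graph by
giving the deleted edge the label `R`. -/
noncomputable def pull (i : Fin 3) (ℓ : D.Vertex → D.Vertex → Finset ℕ) (R : Finset ℕ) (v w : V) :
    Finset ℕ :=
  if hv : v ≠ D.x i ∧ v ≠ D.y i then ℓ (.old i v hv.1 hv.2) (D.out i v w)
  else if hw : w ≠ D.x i ∧ w ≠ D.y i then ℓ (.old i w hw.1 hw.2) (D.out i w v)
  else R

variable {ℓ : D.Vertex → D.Vertex → Finset ℕ} {R : Finset ℕ} {i : Fin 3}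

theorem pull_of_ne {v : V} (hx : v ≠ D.x i) (hy : v ≠ D.y i) (w : V) :
    D.pull i ℓ R v w = ℓ (.old i v hx hy) (D.out i v w) := by
  simp [pull, hx, hy]

theorem pull_symm (hs : ∀ v w, ℓ v w = ℓ w v) (v w : V) :
    D.pull i ℓ R v w = D.pull i ℓ R w v := by
  by_cases hv : v ≠ D.x i ∧ v ≠ D.y i <;> by_cases hw : w ≠ D.x i ∧ w ≠ D.y i
  · rw [D.pull_of_ne hv.1 hv.2, D.pull_of_ne hw.1 hw.2, D.out_old i v hw.1 hw.2,
      D.out_old i w hv.1 hv.2, hs]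
  all_goals simp only [pull, hv, hw, dif_neg, not_false_eq_true]

theorem pull_x_nx (hs : ∀ v w, ℓ v w = ℓ w v) :
    D.pull i ℓ R (D.x i) (D.nx i 0) = ℓ (.a (i - 1)) (D.px i 0) ∧
    D.pull i ℓ R (D.x i) (D.nx i 1) = ℓ (.b (i - 1)) (D.px i 1) := by
  constructor <;>
    rw [D.pull_symm hs, D.pull_of_ne (D.nx_ne_x i _) (D.nx_ne_y i _), hs] <;> simp [px]

theorem pull_y_ny (hs : ∀ v w, ℓ v w = ℓ w v) :
    D.pull i ℓ R (D.y i) (D.ny i 0) = ℓ (.a (i + 1)) (D.py i 0) ∧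
    D.pull i ℓ R (D.y i) (D.ny i 1) = ℓ (.b (i + 1)) (D.py i 1) := by
  constructor <;>
    rw [D.pull_symm hs, D.pull_of_ne (D.ny_ne_x i _) (D.ny_ne_y i _), hs] <;> simp [py]

theorem pull_x_y : D.pull i ℓ R (D.x i) (D.y i) = R := by simp [pull]

theorem evenAt_pull {v : V} {hx : v ≠ D.x i} {hy : v ≠ D.y i}
    (h : EvenAt D.graph ℓ (.old i v hx hy)) : EvenAt G (D.pull i ℓ R) v := by
  intro p q r hn
  simp only [D.pull_of_ne hx hy]
  exact h _ _ _ (D.hasNeighbors_old i hx hy hn)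

theorem tightAt_pull {v : V} {hx : v ≠ D.x i} {hy : v ≠ D.y i}
    (h : TightAt D.graph ℓ (.old i v hx hy)) : TightAt G (D.pull i ℓ R) v := by
  refine ⟨D.evenAt_pull h.1, fun p q r hn => ?_⟩
  simp only [D.pull_of_ne hx hy]
  exact h.2 _ _ _ (D.hasNeighbors_old i hx hy hn)

/-- Handshake modulo 2 for each colour `k` in the copy of `G`: inner vertices contribute 0, and the
deleted edge, labelled `∅`, contributes nothing, so the contributions of `x_i` and `y_i` agree. -/
theorem tile_symmDiff [Finite V] (hG : IsCubic G) (hs : ∀ v w, ℓ v w = ℓ w v)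
    (he : ∀ v hx hy, EvenAt D.graph ℓ (.old i v hx hy)) :
    ℓ (.a (i - 1)) (D.px i 0) ∆ ℓ (.b (i - 1)) (D.px i 1) =
      ℓ (.a (i + 1)) (D.py i 0) ∆ ℓ (.b (i + 1)) (D.py i 1) := by
  classical
  have := Fintype.ofFinite V
  ext k
  have h := sum_sum_eq_zero_of_symm
    (fun v w => if G.Adj v w then (if k ∈ D.pull i ℓ ∅ v w then (1 : ZMod 2) else 0) else 0)
    (fun v w => by simp only [D.pull_symm hs v w, G.adj_comm v w]) (fun v => by simp)
  rw [Fintype.sum_eq_add _ _ (D.x_ne_y i), (D.hasNeighbors_x i).sum, (D.hasNeighbors_y i).sum,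
    D.pull_symm hs (D.y i) (D.x i), D.pull_x_y, (D.pull_x_nx hs).1, (D.pull_x_nx hs).2,
    (D.pull_y_ny hs).1, (D.pull_y_ny hs).2] at h
  · simp only [Finset.mem_symmDiff]
    revert h
    simp only [Finset.notMem_empty, if_false, add_zero]
    split_ifs <;> simp_all <;> decide
  · rintro v ⟨hx, hy⟩
    obtain ⟨p, q, r, hn⟩ := hG v
    rw [hn.sum]
    have := (D.evenAt_pull (R := ∅) (he v hx hy) _ _ _ hn).2
    rw [← this]
    simp only [Finset.mem_symmDiff]
    split_ifs <;> simp_all <;> decide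

/-- Sizes are 1 or 2, and the triangle and parity rules for `∆` apply at both ends. What they still
allow beyond `TileSizes` is excluded by `good`. -/
theorem tile_sizes [Finite V] (hG : IsCubic G) (hn : NoTightLabeling G)
    (hs : ∀ v w, ℓ v w = ℓ w v) (ht : ∀ v hx hy, TightAt D.graph ℓ (.old i v hx hy)) :
    TileSizes (ℓ (.a (i - 1)) (D.px i 0)).card (ℓ (.b (i - 1)) (D.px i 1)).card
      (ℓ (.a (i + 1)) (D.py i 0)).card (ℓ (.b (i + 1)) (D.py i 1)).card
      (ℓ (.a (i - 1)) (D.px i 0) ∆ ℓ (.b (i - 1)) (D.px i 1)).card := by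
  have hsym := D.tile_symmDiff hG hs fun v hx hy => (ht v hx hy).1
  have bound : ∀ v hx hy w, G.Adj v w →
      1 ≤ (ℓ (.old i v hx hy) (D.out i v w)).card ∧ (ℓ (.old i v hx hy) (D.out i v w)).card ≤ 2 := by
    intro v hx hy w hw
    obtain ⟨p, q, r, h⟩ := hG v
    have h' := D.hasNeighbors_old i hx hy h
    have h1 := (ht v hx hy).1.one_le h'
    have h2 := (ht v hx hy).2 _ _ _ h'
    rcases (h.2.2.2 w).1 hw with rfl | rfl | rfl <;> omega
  have bx0 := bound _ (D.nx_ne_x i 0) (D.nx_ne_y i 0) _ (D.nx_mem i 0).1.symm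
  have bx1 := bound _ (D.nx_ne_x i 1) (D.nx_ne_y i 1) _ (D.nx_mem i 1).1.symm
  have by0 := bound _ (D.ny_ne_x i 0) (D.ny_ne_y i 0) _ (D.ny_mem i 0).1.symm
  have by1 := bound _ (D.ny_ne_x i 1) (D.ny_ne_y i 1) _ (D.ny_mem i 1).1.symm
  rw [out_nx_zero, hs] at bx0
  rw [out_nx_one, hs] at bx1
  rw [out_ny_zero, hs] at by0
  rw [out_ny_one, hs] at by1
  -- Otherwise the label `R` on the deleted edge would make the whole copy of `G` tight.
  have good : ¬ ((ℓ (.a (i - 1)) (D.px i 0)).card + (ℓ (.b (i - 1)) (D.px i 1)).card +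
        (ℓ (.a (i - 1)) (D.px i 0) ∆ ℓ (.b (i - 1)) (D.px i 1)).card = 4 ∧
      (ℓ (.a (i + 1)) (D.py i 0)).card + (ℓ (.b (i + 1)) (D.py i 1)).card +
        (ℓ (.a (i - 1)) (D.px i 0) ∆ ℓ (.b (i - 1)) (D.px i 1)).card = 4 ∧
      1 ≤ (ℓ (.a (i - 1)) (D.px i 0) ∆ ℓ (.b (i - 1)) (D.px i 1)).card) := by
    rintro ⟨h1, h2, h3⟩
    set R := ℓ (.a (i - 1)) (D.px i 0) ∆ ℓ (.b (i - 1)) (D.px i 1) with hR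
    refine hn (D.pull i ℓ R) (D.pull_symm hs) fun v => ?_
    by_cases hx : v = D.x i
    · subst hx
      refine (D.hasNeighbors_x i).tightAt ?_ ?_ ?_ ?_ ?_ <;>
        simp only [D.pull_x_nx hs, D.pull_x_y]
      exacts [Finset.card_pos.1 bx0.1, Finset.card_pos.1 bx1.1, Finset.card_pos.1 h3, rfl, h1]
    by_cases hy : v = D.y i
    · subst hy
      refine (D.hasNeighbors_y i).tightAt ?_ ?_ ?_ ?_ ?_ <;>
        simp only [D.pull_y_ny hs, D.pull_symm hs (D.y i) (D.x i), D.pull_x_y]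
      exacts [Finset.card_pos.1 by0.1, Finset.card_pos.1 by1.1, Finset.card_pos.1 h3, hsym.symm, h2]
    exact D.tightAt_pull (ht v hx hy)
  obtain ⟨⟨m, tx⟩, tx'⟩ := Finset.card_symmDiff_triangle
    (ℓ (.a (i - 1)) (D.px i 0)) (ℓ (.b (i - 1)) (D.px i 1))
  obtain ⟨⟨m', ty⟩, ty'⟩ := Finset.card_symmDiff_triangle
    (ℓ (.a (i + 1)) (D.py i 0)) (ℓ (.b (i + 1)) (D.py i 1))
  rw [← hsym] at ty ty'
  simp only [px, py] at *
  unfold TileSizes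
  omega

end WindmillData

/-! ### Hubs: no tight labelling of a windmill graph. -/

theorem TileSizes.swap {x₀ x₁ y₀ y₁ r : ℕ} (h : TileSizes x₀ x₁ y₀ y₁ r) :
    TileSizes x₁ x₀ y₁ y₀ r := by
  unfold TileSizes at *; omega

/-- The sizes of the labels near a hub `{a, b, c}` of which `c` and `a` have been removed. -/
theorem hub_arith {x₀ x₀' y₀ y₀' r₀ x₁ x₁' y₁ y₁' r₁ x₂ x₂' y₂ y₂' r₂ p₁ q₁ l₁ p₂ q₂ l₂ U B : ℕ}
    (t₀ : TileSizes x₀ x₀' y₀ y₀' r₀) (t₁ : TileSizes x₁ x₁' y₁ y₁' r₁)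
    (t₂ : TileSizes x₂ x₂' y₂ y₂' r₂)
    (a₁ : x₂ + y₀ + p₁ = 4) (b₁ : x₂' + y₀' + q₁ = 4) (c₁ : p₁ + q₁ + l₁ = 4)
    (a₂ : x₀ + y₁ + p₂ = 4) (b₂ : x₀' + y₁' + q₂ = 4) (c₂ : p₂ + q₂ + l₂ = 4)
    (hp₁ : 1 ≤ p₁ ∧ 1 ≤ q₁ ∧ 1 ≤ l₁) (hp₂ : 1 ≤ p₂ ∧ 1 ≤ q₂ ∧ 1 ≤ l₂)
    (u : l₁ + l₂ + U = 4) (hU : 1 ≤ U) (b : x₁' + y₂' + B = 4) (hB : 1 ≤ B)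
    (d₁ : l₁ ≤ r₂ + r₀ ∧ r₂ ≤ l₁ + r₀ ∧ r₀ ≤ l₁ + r₂)
    (d₂ : l₂ ≤ r₀ + r₁ ∧ r₀ ≤ l₂ + r₁ ∧ r₁ ≤ l₂ + r₀)
    (d₃ : U ≤ r₁ + r₂ ∧ r₁ ≤ U + r₂ ∧ r₂ ≤ U + r₁) :
    U = 1 ∧ B = 1 ∧ x₁ = 2 ∧ y₂ = 2 := by
  -- Indices 1 and 2 are the tiles next to the open hub, 0 the tile opposite it. Each tile has
  -- difference of size 0, 2, 4 or 3, which gives 64 linear cases.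
  obtain ⟨h₀, ⟨rfl, rfl, t₀ | t₀ | t₀⟩ | t₀⟩ := t₀ <;>
  obtain ⟨h₁, ⟨rfl, rfl, t₁ | t₁ | t₁⟩ | t₁⟩ := t₁ <;>
  obtain ⟨h₂, ⟨rfl, rfl, t₂ | t₂ | t₂⟩ | t₂⟩ := t₂ <;>
  first
  | (exfalso; omega)
  | (refine ⟨?_, ?_, ?_, ?_⟩ <;> omega)

namespace WindmillData

variable {V : Type*} {G : SimpleGraph V} (D : WindmillData G)
  {ℓ : D.Vertex → D.Vertex → Finset ℕ}

/-- Adding the parity conditions at `a_j`, `b_j` and `c_j` cancels the edges inside the hub. -/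
theorem EvenAt.spoke {j : Fin 3} (hs : ∀ v w, ℓ v w = ℓ w v)
    (ha : EvenAt D.graph ℓ (.a j)) (hb : EvenAt D.graph ℓ (.b j)) (hc : EvenAt D.graph ℓ (.c j)) :
    ℓ .u (.c j) = (ℓ (.a j) (D.px (j + 1) 0) ∆ ℓ (.b j) (D.px (j + 1) 1)) ∆
      (ℓ (.a j) (D.py (j - 1) 0) ∆ ℓ (.b j) (D.py (j - 1) 1)) := by
  rw [symmDiff_symmDiff_symmDiff_comm, (ha _ _ _ (D.hasNeighbors_a j)).2,
    (hb _ _ _ (D.hasNeighbors_b j)).2, hs .u, ← (hc _ _ _ (D.hasNeighbors_c j)).2, hs (.c j),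
    hs (.c j)]

theorem exists_other_indices (j : Fin 3) : ∃ k m : Fin 3, k ≠ j ∧ m ≠ j ∧ j + 1 = k ∧ k + 1 = m ∧
    m + 1 = j ∧ j - 1 = m ∧ k - 1 = j ∧ m - 1 = k ∧
    HasNeighbors D.graph .u (.c k) (.c m) (.c j) := by
  have h := D.hasNeighbors_u
  refine ⟨j + 1, j + 2, ?_⟩
  fin_cases j
  exacts [⟨by decide, by decide, rfl, rfl, rfl, rfl, rfl, rfl, h.rotate⟩,
    ⟨by decide, by decide, rfl, rfl, rfl, rfl, rfl, rfl, h.rotate.rotate⟩,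
    ⟨by decide, by decide, rfl, rfl, rfl, rfl, rfl, rfl, h⟩]

/-- The two halves serve the deleted edges `c_j a_j` and `c_j b_j`; exchanging `a` with `b` and the
superscripts 0 and 1 carries one into the other. -/
theorem hub_sizes [Finite V] (hG : IsCubic G) (hn : NoTightLabeling G)
    (hs : ∀ v w, ℓ v w = ℓ w v) (j : Fin 3)
    (ht : ∀ v, v ≠ .a j → v ≠ .b j → v ≠ .c j → TightAt D.graph ℓ v) :
    (TightAt D.graph ℓ (.b j) → (ℓ (.c j) .u).card = 1 ∧ (ℓ (.c j) (.b j)).card = 1 ∧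
      (ℓ (.a j) (D.px (j + 1) 0)).card = 2 ∧ (ℓ (.a j) (D.py (j - 1) 0)).card = 2) ∧
    (TightAt D.graph ℓ (.a j) → (ℓ (.c j) .u).card = 1 ∧ (ℓ (.c j) (.a j)).card = 1 ∧
      (ℓ (.b j) (D.px (j + 1) 1)).card = 2 ∧ (ℓ (.b j) (D.py (j - 1) 1)).card = 2) := by
  have tile : ∀ i, _ := fun i => D.tile_sizes (i := i) hG hn hs
    fun v hx hy => ht _ (by simp) (by simp) (by simp)
  have tsym : ∀ i, _ := fun i => D.tile_symmDiff (i := i) hG hs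
    fun v hx hy => (ht _ (by simp) (by simp) (by simp)).1
  have hub : ∀ k, k ≠ j → _ := fun k hk =>
    have ta := ht (.a k) (by simpa) (by simp) (by simp)
    have tb := ht (.b k) (by simp) (by simpa) (by simp)
    have tc := ht (.c k) (by simp) (by simp) (by simpa)
    And.intro (ta.2 _ _ _ (D.hasNeighbors_a k)) <| And.intro (tb.2 _ _ _ (D.hasNeighbors_b k)) <|
      And.intro (tc.2 _ _ _ (D.hasNeighbors_c k)) <|
      And.intro (tc.1.one_le (D.hasNeighbors_c k)) (EvenAt.spoke D hs ta.1 tb.1 tc.1)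
  have hu := ht .u (by simp) (by simp) (by simp)
  have tri : ∀ A B C : Finset ℕ, A = B ∆ C →
      A.card ≤ B.card + C.card ∧ B.card ≤ A.card + C.card ∧ C.card ≤ A.card + B.card := by
    rintro A B C rfl
    have := Finset.card_symmDiff_triangle B C
    omega
  have hb : ∀ k, TightAt D.graph ℓ (.b k) → _ :=
    fun k tb => And.intro (tb.2 _ _ _ (D.hasNeighbors_b k)) (tb.1.one_le (D.hasNeighbors_b k))
  have ha : ∀ k, TightAt D.graph ℓ (.a k) → _ :=
    fun k tb => And.intro (tb.2 _ _ _ (D.hasNeighbors_a k)) (tb.1.one_le (D.hasNeighbors_a k))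
  obtain ⟨k, m, hkj, hmj, e1, e2, e3, e4, e5, e6, hnu⟩ := D.exists_other_indices j
  obtain ⟨ak, bk, ck, ok, sk⟩ := hub k hkj
  obtain ⟨am, bm, cm, om, sm⟩ := hub m hmj
  have tj := tile j
  have tk := tile k
  have tm := tile m
  have sj' := tsym j
  have sk' := tsym k
  have sm' := tsym m
  have haj := ha j
  have hbj := hb j
  have u1 := hu.2 _ _ _ hnu
  have u2 := (hu.1.one_le hnu).2.2
  have u3 := tri _ _ _ (hu.1 _ _ _ hnu).2.symm
  have u4 := (hu.1 _ _ _ hnu).2.symm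
  simp only [e1, e2, e3, e4, e5, e6, hs .u, hs _ (.c j), hs _ (.c k), hs _ (.c m)] at *
  rw [← sj'] at sk
  rw [← sk'] at sm
  -- The difference of the opposite tile `j` occurs in both closed spokes and cancels. This
  -- determines the open spoke without any parity at the hub `j`.
  rw [sk, sm, symmDiff_assoc, symmDiff_symmDiff_cancel_left] at u4
  have d1 := tri _ _ _ sk
  have d2 := tri _ _ _ sm
  have d3 := tri _ _ _ u4
  constructor <;> intro h
  · obtain ⟨h1, h2, h3, h4⟩ := hbj h
    exact hub_arith tj tk tm ak bk ck am bm cm ok om u1 u2 h1 h4 (by omega) (by omega) (by omega)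
  · obtain ⟨h1, h2, h3, h4⟩ := haj h
    exact hub_arith tj.swap tk.swap tm.swap bk ak (by omega) bm am (by omega) (by omega)
      (by omega) u1 u2 h1 h4 (by omega) (by omega) (by omega)

/-- The windmill construction preserves the absence of tight labellings. -/
theorem graph_noTightLabeling [Finite V] (hG : IsCubic G) (hn : NoTightLabeling G) :
    NoTightLabeling D.graph := by
  intro ℓ hs ht
  have h : ∀ j, (ℓ (.c j) .u).card = 1 := fun j =>
    ((D.hub_sizes hG hn hs j fun v _ _ _ => ht v).1 (ht _)).1
  -- The sizes at `u` would be 1, 1, 1, with sum 3 instead of 4.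
  have hu := (ht _).2 _ _ _ D.hasNeighbors_u
  simp only [hs .u, h] at hu
  omega

end WindmillData

/-! ### The second windmill: oriented tiles. -/

namespace WindmillData

variable {V : Type*} {G : SimpleGraph V} (D : WindmillData G)

theorem edge_sizes [Finite V] (hG : IsCubic G) (hn : NoTightLabeling G)
    {ℓ : D.Vertex → D.Vertex → Finset ℕ} (hs : ∀ v w, ℓ v w = ℓ w v) (j : Fin 3) {z : D.Vertex}
    (hz : z = .a j ∨ z = .b j)
    (ht : ∀ v, v ≠ .c j → v ≠ z → TightAt D.graph ℓ v) :
    (∀ w, D.graph.Adj (.c j) w → w ≠ z → (ℓ (.c j) w).card = 1) ∧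
      (∀ w, D.graph.Adj z w → w ≠ .c j → (ℓ z w).card = 2) := by
  have nc := (D.hasNeighbors_c j).2.2.2
  rcases hz with rfl | rfl
  · obtain ⟨h1, h2, h3, h4⟩ := (D.hub_sizes hG hn hs j fun v ha _ hc => ht v hc ha).1
      (ht _ (by simp) (by simp))
    have na := (D.hasNeighbors_a j).2.2.2
    constructor
    · intro w hw hne
      rcases (nc w).1 hw with rfl | rfl | rfl <;> first | contradiction | assumption
    · intro w hw hne
      rcases (na w).1 hw with rfl | rfl | rfl <;> first | contradiction | assumption
  · obtain ⟨h1, h2, h3, h4⟩ := (D.hub_sizes hG hn hs j fun v _ hb hc => ht v hc hb).2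
      (ht _ (by simp) (by simp))
    have nb := (D.hasNeighbors_b j).2.2.2
    constructor
    · intro w hw hne
      rcases (nc w).1 hw with rfl | rfl | rfl <;> first | contradiction | assumption
    · intro w hw hne
      rcases (nb w).1 hw with rfl | rfl | rfl <;> first | contradiction | assumption

variable {D} (E : WindmillData D.graph)

/-- Pulling the labels back to the copy of `D.graph` reduces this to `edge_sizes`. The deleted edge
may receive `∅`, since tightness at its ends is not needed. -/
theorem oriented_tile_sizes [Finite V] (hG : IsCubic G) (hn : NoTightLabeling G)
    {ℓ : E.Vertex → E.Vertex → Finset ℕ} (hs : ∀ v w, ℓ v w = ℓ w v) (i : Fin 3)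
    (ht : ∀ v hx hy, TightAt E.graph ℓ (.old i v hx hy))
    (hE : ∃ j : Fin 3, s(E.x i, E.y i) = s(Vertex.c j, Vertex.a j) ∨
      s(E.x i, E.y i) = s(Vertex.c j, Vertex.b j)) :
    ((∃ j, E.x i = .c j) →
      (ℓ (.a (i - 1)) (E.px i 0)).card = 1 ∧ (ℓ (.b (i - 1)) (E.px i 1)).card = 1 ∧
      (ℓ (.a (i + 1)) (E.py i 0)).card = 2 ∧ (ℓ (.b (i + 1)) (E.py i 1)).card = 2) ∧
    ((∃ j, E.y i = .c j) →
      (ℓ (.a (i - 1)) (E.px i 0)).card = 2 ∧ (ℓ (.b (i - 1)) (E.px i 1)).card = 2 ∧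
      (ℓ (.a (i + 1)) (E.py i 0)).card = 1 ∧ (ℓ (.b (i + 1)) (E.py i 1)).card = 1) := by
  have tight : ∀ v, v ≠ E.x i → v ≠ E.y i → TightAt D.graph (E.pull i ℓ ∅) v :=
    fun v hx hy => E.tightAt_pull (ht v hx hy)
  have psymm := E.pull_symm (i := i) (R := ∅) hs
  obtain ⟨hx0, hx1⟩ := E.pull_x_nx (i := i) (R := ∅) hs
  obtain ⟨hy0, hy1⟩ := E.pull_y_ny (i := i) (R := ∅) hs
  rw [← hx0, ← hx1, ← hy0, ← hy1]
  obtain ⟨j, hj⟩ := hE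
  have hj' : ∃ z, (z = .a j ∨ z = .b j) ∧ s(E.x i, E.y i) = s(Vertex.c j, z) := by
    rcases hj with h | h
    exacts [⟨_, Or.inl rfl, h⟩, ⟨_, Or.inr rfl, h⟩]
  obtain ⟨z, hz, h⟩ := hj'
  rcases Sym2.eq_iff.1 h with ⟨h1, h2⟩ | ⟨h1, h2⟩
  · obtain ⟨k1, k2⟩ := D.edge_sizes hG hn psymm j hz
      fun v hv hv' => tight v (h1 ▸ hv) (h2 ▸ hv')
    rw [← h1, ← h2] at k1 k2
    constructor
    · intro _
      exact ⟨k1 _ (E.nx_mem i 0).1 (E.nx_mem i 0).2, k1 _ (E.nx_mem i 1).1 (E.nx_mem i 1).2,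
        k2 _ (E.ny_mem i 0).1 (E.ny_mem i 0).2, k2 _ (E.ny_mem i 1).1 (E.ny_mem i 1).2⟩
    · rintro ⟨j', h3⟩
      rw [h2] at h3
      subst h3
      simp at hz
  · obtain ⟨k1, k2⟩ := D.edge_sizes hG hn psymm j hz
      fun v hv hv' => tight v (h1 ▸ hv') (h2 ▸ hv)
    rw [← h1, ← h2] at k1 k2
    constructor
    · rintro ⟨j', h3⟩
      rw [h1] at h3
      subst h3
      simp at hz
    · intro _
      exact ⟨k2 _ (E.nx_mem i 0).1 (E.nx_mem i 0).2, k2 _ (E.nx_mem i 1).1 (E.nx_mem i 1).2,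
        k1 _ (E.ny_mem i 0).1 (E.ny_mem i 0).2, k1 _ (E.ny_mem i 1).1 (E.ny_mem i 1).2⟩

/-- Of three copies with two orientations, both occurring, one stands against the other two. -/
theorem mixed_orientation {A B : Fin 3 → Prop} (h : ∀ i, A i ∨ B i) (hA : ∃ i, A i)
    (hB : ∃ i, B i) : (∃ k, B k ∧ A (k + 1) ∧ A (k - 1)) ∨ ∃ k, A k ∧ B (k + 1) ∧ B (k - 1) := by
  have key : ∀ a b : Fin 3 → Bool, (∀ i, a i ∨ b i) → (∃ i, a i) → (∃ i, b i) →
      (∃ k, b k ∧ a (k + 1) ∧ a (k - 1)) ∨ ∃ k, a k ∧ b (k + 1) ∧ b (k - 1) := by decide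
  classical
  simpa using key (fun i => decide (A i)) (fun i => decide (B i)) (by simpa using h)
    (by simpa using hA) (by simpa using hB)

/-- Let `k` be the odd tile, with successor `l` and predecessor `m`. If `y_k` is the end of size 1,
hub `m` receives 2 and 2 at both `a_m` and `b_m`, too much for a sum of 4; hub `l` receives 1 and 1,
so two edges of size 2 meet at `c_l`. -/
theorem not_tight_off_one_vertex [Finite V] (hG : IsCubic G) (hn : NoTightLabeling G)
    (hE : ∀ i, ∃ j : Fin 3, s(E.x i, E.y i) = s(Vertex.c j, Vertex.a j) ∨
      s(E.x i, E.y i) = s(Vertex.c j, Vertex.b j))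
    (hx : ∃ i j, E.x i = Vertex.c j) (hy : ∃ i j, E.y i = Vertex.c j)
    {ℓ : E.Vertex → E.Vertex → Finset ℕ} (hs : ∀ v w, ℓ v w = ℓ w v)
    (he : ∀ v, EvenAt E.graph ℓ v) (z : E.Vertex) :
    ¬ ∀ v, v ≠ z → TightAt E.graph ℓ v := by
  intro ht
  have tile : ∀ i, (∀ v hx hy, z ≠ .old i v hx hy) → _ := fun i h =>
    oriented_tile_sizes E hG hn hs i (fun v hx hy => ht _ (h v hx hy).symm) (hE i)
  have sa : ∀ i, z ≠ .a i → _ := fun i h => (ht _ h.symm).2 _ _ _ (E.hasNeighbors_a i)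
  have sb : ∀ i, z ≠ .b i → _ := fun i h => (ht _ h.symm).2 _ _ _ (E.hasNeighbors_b i)
  have sc : ∀ i, z ≠ .c i → _ := fun i h => (ht _ h.symm).2 _ _ _ (E.hasNeighbors_c i)
  have pc : ∀ i, _ := fun i => (he _).one_le (E.hasNeighbors_c i)
  rcases mixed_orientation (A := fun i => ∃ j, E.x i = .c j) (B := fun i => ∃ j, E.y i = .c j)
    (fun i => by
      obtain ⟨j, hj⟩ := hE i
      simp only [Sym2.eq_iff] at hj
      grind) hx hy with ⟨k, ok, ok1, ok2⟩ | ⟨k, ok, ok1, ok2⟩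
  · obtain ⟨l, m, hlk, hmk, e1, e2, e3, e4, e5, e6, hnu⟩ := E.exists_other_indices k
    have hlm : l ≠ m := by rintro rfl; subst e1; revert e2; clear * -; revert k; decide
    have hi : ∀ i : Fin 3, i = k ∨ i = l ∨ i = m := by
      subst e1 e4; clear * -; revert k; decide
    have su : z ≠ .u → _ := fun h => (ht _ h.symm).2 _ _ _ hnu
    have tk := fun h => (tile k h).2 ok
    have tl := fun h => (tile l h).1 (e1 ▸ ok1)
    have tm := fun h => (tile m h).1 (e4 ▸ ok2)
    have ak := sa k
    have al := sa l
    have am := sa m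
    have bk := sb k
    have bl := sb l
    have bm := sb m
    have ck := sc k
    have cl := sc l
    have cm := sc m
    have pu := pc k
    have pl := pc l
    have pm := pc m
    have qal := (he _).one_le (E.hasNeighbors_a l)
    have qam := (he _).one_le (E.hasNeighbors_a m)
    have qbl := (he _).one_le (E.hasNeighbors_b l)
    have qbm := (he _).one_le (E.hasNeighbors_b m)
    clear sa sb sc pc
    simp only [e1, e2, e3, e4, e5, e6, hs .u, hs _ (.c k), hs _ (.c l), hs _ (.c m)] at *
    cases z with
    | old i v hx hy =>
      simp only [ne_eq, reduceCtorEq, not_false_eq_true, forall_true_left] at *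
      -- One tile is unknown. If it is `k`, hubs `k` and `m` both send a spoke of size 2 to `u`; if
      -- it is `l`, `c_l` fails; if it is `m`, `a_m` fails.
      rcases hi i with rfl | rfl | rfl
      · have := tl (by simp [Ne.symm hlk])
        have := tm (by simp [Ne.symm hmk])
        omega
      · have := tk (by simp [hlk])
        have := tm (by simp [hlm])
        omega
      · have := tk (by simp [hmk])
        have := tl (by simp [Ne.symm hlm])
        omega
    -- All tiles are intact, so `a_m` and `b_m` both fail, and at least one of them differs from
    -- `z`.
    | a i =>
      have := tk (by simp)
      have := tl (by simp)
      have := tm (by simp)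
      have := bm (by simp)
      omega
    | b i | c i | u =>
      have := tk (by simp)
      have := tl (by simp)
      have := tm (by simp)
      have := am (by simp)
      omega
  -- The mirror image: now the sizes 2 and 2 meet at hub `l`, and 1 and 1 at hub `m`.
  · obtain ⟨l, m, hlk, hmk, e1, e2, e3, e4, e5, e6, hnu⟩ := E.exists_other_indices k
    have hlm : l ≠ m := by rintro rfl; subst e1; revert e2; clear * -; revert k; decide
    have hi : ∀ i : Fin 3, i = k ∨ i = l ∨ i = m := by
      subst e1 e4; clear * -; revert k; decide
    have su : z ≠ .u → _ := fun h => (ht _ h.symm).2 _ _ _ hnu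
    have tk := fun h => (tile k h).1 ok
    have tl := fun h => (tile l h).2 (e1 ▸ ok1)
    have tm := fun h => (tile m h).2 (e4 ▸ ok2)
    have ak := sa k
    have al := sa l
    have am := sa m
    have bk := sb k
    have bl := sb l
    have bm := sb m
    have ck := sc k
    have cl := sc l
    have cm := sc m
    have pu := pc k
    have pl := pc l
    have pm := pc m
    have qal := (he _).one_le (E.hasNeighbors_a l)
    have qam := (he _).one_le (E.hasNeighbors_a m)
    have qbl := (he _).one_le (E.hasNeighbors_b l)
    have qbm := (he _).one_le (E.hasNeighbors_b m)
    clear sa sb sc pc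
    simp only [e1, e2, e3, e4, e5, e6, hs .u, hs _ (.c k), hs _ (.c l), hs _ (.c m)] at *
    cases z with
    | old i v hx hy =>
      simp only [ne_eq, reduceCtorEq, not_false_eq_true, forall_true_left] at *
      rcases hi i with rfl | rfl | rfl
      · have := tl (by simp [Ne.symm hlk])
        have := tm (by simp [Ne.symm hmk])
        omega
      · have := tk (by simp [hlk])
        have := tm (by simp [hlm])
        omega
      · have := tk (by simp [hmk])
        have := tl (by simp [Ne.symm hlm])
        omega
    | a i =>
      have := tk (by simp)
      have := tl (by simp)
      have := tm (by simp)
      have := bl (by simp)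
      omega
    | b i | c i | u =>
      have := tk (by simp)
      have := tl (by simp)
      have := tm (by simp)
      have := al (by simp)
      omega

end WindmillData

/-! ### From cycle covers to labellings. -/

section Cover

variable {V : Type*} {G : SimpleGraph V}

theorem SimpleGraph.Subgraph.sum_adj_eq_two_mul_ncard [Fintype V] (H : G.Subgraph)
    [DecidableRel H.Adj] :
    ∑ v, ∑ w, (if H.Adj v w then 1 else 0) = 2 * H.edgeSet.ncard := by
  classical
  have h := H.spanningCoe.sum_degrees_eq_twice_card_edges
  rw [← H.edgeSet_spanningCoe, Set.ncard_eq_toFinset_card', ← SimpleGraph.edgeFinset, ← h]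
  refine Finset.sum_congr rfl fun v _ => ?_
  rw [← SimpleGraph.card_neighborFinset_eq_degree, SimpleGraph.neighborFinset_eq_filter,
    Finset.card_filter]
  exact Finset.sum_congr rfl fun w _ => by simp

/-- Indexing gives repeated cycles of a cover distinct colours; the default value is used only
beyond the length of the list. -/
theorem Multiset.exists_eq_map_range {α : Type*} [Inhabited α] (C : Multiset α) :
    ∃ (n : ℕ) (f : ℕ → α), C = (Multiset.range n).map f := by
  induction C using Quotient.inductionOn with
  | h l =>
    refine ⟨l.length, fun k => l.getD k default, ?_⟩
    change (l : Multiset α) = ((List.range l.length : List ℕ) : Multiset ℕ).map _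
    rw [Multiset.map_coe]
    congr 1
    refine List.ext_getElem (by simp) fun k h1 h2 => by simp [h1]

open Classical in
/-- The label of an edge: the set of indices of the subgraphs containing it. -/
noncomputable def coverLabel (n : ℕ) (H : ℕ → G.Subgraph) (v w : V) : Finset ℕ :=
  (Finset.range n).filter fun k => (H k).Adj v w

theorem coverLabel_symm (n : ℕ) (H : ℕ → G.Subgraph) (v w : V) :
    coverLabel n H v w = coverLabel n H w v := by
  ext k
  simp [coverLabel, (H k).adj_comm v w]

theorem coverLabel_evenAt {n : ℕ} {H : ℕ → G.Subgraph}
    (hc : IsCycleCover G ((Multiset.range n).map H)) (v : V) :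
    EvenAt G (coverLabel n H) v := by
  classical
  intro p q r h
  refine ⟨?_, ?_⟩
  · obtain ⟨K, hK, he⟩ := hc.2 s(v, p) h.adj
    obtain ⟨k, hk, rfl⟩ := Multiset.mem_map.1 hK
    refine ⟨k, ?_⟩
    simp only [coverLabel, Finset.mem_filter, Finset.mem_range]
    exact ⟨Multiset.mem_range.1 hk, he⟩
  · ext k
    simp only [coverLabel, Finset.mem_symmDiff, Finset.mem_filter, Finset.mem_range]
    by_cases hk : k < n
    swap
    · simp [hk]
    have hev : Even ((H k).neighborSet v).ncard := by
      -- Evenness is assumed only at vertices of the cycle; elsewhere the degree is 0.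
      by_cases hv : v ∈ (H k).verts
      · exact (hc.1 _ (Multiset.mem_map.2 ⟨k, Multiset.mem_range.2 hk, rfl⟩)).2 v hv
      · have : (H k).neighborSet v = ∅ := by
          ext w
          simp only [SimpleGraph.Subgraph.mem_neighborSet, Set.mem_empty_iff_false, iff_false]
          exact fun h => hv h.fst_mem
        simp [this]
    have hset : (H k).neighborSet v = (({p, q, r} : Finset V).filter fun w => (H k).Adj v w) := by
      ext w
      simp only [SimpleGraph.Subgraph.mem_neighborSet, Finset.coe_filter, Finset.mem_insert,
        Finset.mem_singleton, Set.mem_ofPred_eq]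
      exact ⟨fun hw => ⟨(h.2.2.2 w).1 hw.adj_sub, hw⟩, fun hw => hw.2⟩
    rw [hset, Set.ncard_coe_finset, Finset.card_filter, Finset.sum_insert (by simp [h.1, h.2.1]),
      Finset.sum_insert (by simp [h.2.2.1]), Finset.sum_singleton] at hev
    revert hev
    simp only [hk, true_and]
    split_ifs <;> simp_all +decide

theorem sum_card_coverLabel [Fintype V] (n : ℕ) (H : ℕ → G.Subgraph) :
    ∑ v, ∑ w, (coverLabel n H v w).card = 2 * coverLength ((Multiset.range n).map H) := by
  classical
  have : coverLength ((Multiset.range n).map H) = ∑ k ∈ Finset.range n, (H k).edgeSet.ncard := by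
    simp [coverLength, Finset.sum]
  rw [this, Finset.mul_sum]
  simp only [← SimpleGraph.Subgraph.sum_adj_eq_two_mul_ncard, coverLabel, Finset.card_filter]
  rw [Finset.sum_comm (s := Finset.range n)]
  exact Finset.sum_congr rfl fun v _ => Finset.sum_comm

/-- An even value above 4 is at least 6, so two exceptional vertices would already give 4|V| + 4. -/
theorem exists_forall_ne_of_sum_le [Fintype V] [Nonempty V] (s : V → ℕ) (h4 : ∀ v, 4 ≤ s v)
    (he : ∀ v, Even (s v)) (hs : ∑ v, s v ≤ 4 * Fintype.card V + 3) :
    ∃ z, ∀ v, v ≠ z → s v = 4 := by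
  classical
  by_contra! hcon
  obtain ⟨v, -, hv⟩ := hcon (Classical.arbitrary V)
  obtain ⟨w, hwv, hw⟩ := hcon v
  have e6 : ∀ v, s v ≠ 4 → 6 ≤ s v := fun v hv => by
    obtain ⟨m, hm⟩ := he v
    have := h4 v
    omega
  have : ∑ x, (4 + (if x = v then 2 else 0) + (if x = w then 2 else 0)) ≤ ∑ x, s x := by
    refine Finset.sum_le_sum fun x _ => ?_
    have := h4 x
    split_ifs with h1 h2 h2
    · exact absurd (h2.symm.trans h1) hwv
    · subst h1; have := e6 _ hv; omega
    · subst h2; have := e6 _ hw; omega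
    · omega
  simp [Finset.sum_add_distrib] at this
  omega

theorem IsCubic.two_mul_ncard_edgeSet [Fintype V] (hG : IsCubic G) :
    2 * G.edgeSet.ncard = 3 * Fintype.card V := by
  classical
  rw [Set.ncard_eq_toFinset_card', ← SimpleGraph.edgeFinset, ← G.sum_degrees_eq_twice_card_edges,
    Finset.sum_congr rfl (g := fun _ => 3), Finset.sum_const, smul_eq_mul, mul_comm, Finset.card_univ]
  intro v _
  obtain ⟨p, q, r, h⟩ := hG v
  have := h.ncard
  rwa [Set.ncard_eq_toFinset_card', ← SimpleGraph.neighborFinset,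
    SimpleGraph.card_neighborFinset_eq_degree] at this

theorem IsCubic.le_coverLength [Fintype V] [Nonempty V] (hG : IsCubic G)
    (hℓ : ∀ ℓ : V → V → Finset ℕ, (∀ v w, ℓ v w = ℓ w v) → (∀ v, EvenAt G ℓ v) →
      ∀ z, ¬ ∀ v, v ≠ z → TightAt G ℓ v)
    {C : Multiset G.Subgraph} (hC : IsCycleCover G C) :
    2 * Fintype.card V + 2 ≤ coverLength C := by
  classical
  have : Inhabited G.Subgraph := ⟨⊥⟩
  obtain ⟨n, H, rfl⟩ := Multiset.exists_eq_map_range C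
  by_contra hlt
  have hev := coverLabel_evenAt hC
  have hsum : ∀ v p q r, HasNeighbors G v p q r → ∑ w, (coverLabel n H v w).card =
      (coverLabel n H v p).card + (coverLabel n H v q).card + (coverLabel n H v r).card := by
    intro v p q r h
    rw [← h.sum fun w => (coverLabel n H v w).card]
    refine Finset.sum_congr rfl fun w _ => ?_
    split_ifs with hw
    · rfl
    · rw [Finset.card_eq_zero, coverLabel, Finset.filter_eq_empty_iff]
      exact fun k _ h => hw h.adj_sub
  have hv : ∀ v, 4 ≤ ∑ w, (coverLabel n H v w).card ∧ Even (∑ w, (coverLabel n H v w).card) := by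
    intro v
    obtain ⟨p, q, r, h⟩ := hG v
    rw [hsum v p q r h]
    have h1 := (hev v).one_le h
    obtain ⟨⟨m, h2⟩, -⟩ := Finset.card_symmDiff_triangle (coverLabel n H v p) (coverLabel n H v q)
    rw [(hev v _ _ _ h).2] at h2
    exact ⟨by omega, ⟨m, by omega⟩⟩
  -- The sum is twice the length, hence at most 4|V| + 2.
  obtain ⟨z, hz⟩ := exists_forall_ne_of_sum_le _ (fun v => (hv v).1) (fun v => (hv v).2)
    (by rw [sum_card_coverLabel]; omega)
  exact hℓ _ (coverLabel_symm n H) hev z fun v hvz =>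
    ⟨hev v, fun p q r h => by rw [← hsum v p q r h, hz v hvz]⟩

/-- A three-edge-colouring gives a tight labelling. -/
theorem NoTightLabeling.not_colorable (hn : NoTightLabeling G) (hG : IsCubic G) :
    ¬ G.lineGraph.Colorable 3 := by
  classical
  rintro ⟨c⟩
  -- The symmetric difference of any two of these sets is the third.
  let S : Fin 3 → Finset ℕ := ![{0}, {1}, {0, 1}]
  have hS : ∀ a b d : Fin 3, a ≠ b → a ≠ d → b ≠ d →
      S a ∆ S b = S d ∧ (S a).card + (S b).card + (S d).card = 4 := by decide
  have hS1 : ∀ a, (S a).Nonempty := by decide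
  let ℓ : V → V → Finset ℕ := fun v w => if h : G.Adj v w then S (c ⟨s(v, w), h⟩) else ∅
  have hne : ∀ v p q (hp : G.Adj v p) (hq : G.Adj v q), p ≠ q →
      c ⟨s(v, p), hp⟩ ≠ c ⟨s(v, q), hq⟩ := by
    intro v p q hp hq hpq
    refine c.valid ?_
    rw [SimpleGraph.lineGraph_adj_iff_exists]
    refine ⟨fun h => hpq ?_, v, by simp, by simp⟩
    exact Sym2.congr_right.1 (congrArg Subtype.val h)
  refine hn ℓ ?_ ?_
  · intro v w
    simp only [ℓ, G.adj_comm v w, Sym2.eq_swap]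
  · intro v
    obtain ⟨p, q, r, h⟩ := hG v
    have hp := h.adj
    have hq := h.rotate.adj
    have hr := h.rotate.rotate.adj
    have := hS _ _ _ (hne v p q hp hq h.1) (hne v p r hp hr h.2.1) (hne v q r hq hr h.2.2.1)
    refine h.tightAt ?_ ?_ ?_ ?_ ?_ <;> simp only [ℓ, hp, hq, hr, dif_pos]
    exacts [hS1 _, hS1 _, hS1 _, this.1, this.2]

end Cover

/-! ### Girth. -/

/-- There are no triangles and no cycles of length four. -/
def NoShortCycles {V : Type*} (G : SimpleGraph V) : Prop :=
  (∀ v p q, G.Adj v p → G.Adj v q → ¬ G.Adj p q) ∧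
    ∀ v w, v ≠ w → ∀ p, G.Adj v p → G.Adj w p → ∀ q, G.Adj v q → G.Adj w q → p = q

instance : DecidableRel petersenGraph.Adj := fun _ _ =>
  decidable_of_iff _ (SimpleGraph.fromRel_adj _ _ _).symm

theorem petersen_noShortCycles : NoShortCycles petersenGraph := by
  constructor <;> decide +kernel

theorem NoShortCycles.five_le_egirth {V : Type*} {G : SimpleGraph V} (h : NoShortCycles G) :
    5 ≤ G.egirth := by
  rw [SimpleGraph.le_egirth]
  intro v w hw
  by_contra! hlt
  have h5 : w.length < 5 := by exact_mod_cast hlt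
  have h3 := hw.three_le_length
  have adj : ∀ k, k < w.length → G.Adj (w.getVert k) (w.getVert (k + 1)) :=
    fun k hk => w.adj_getVert_succ hk
  have hend := w.getVert_length
  have h0 := w.getVert_zero
  have inj := hw.getVert_injOn'
  rcases (by omega : w.length = 3 ∨ w.length = 4) with hl | hl
  · rw [hl] at adj hend
    have a0 := adj 0 (by omega)
    have a1 := adj 1 (by omega)
    have a2 : G.Adj (w.getVert 2) (w.getVert 0) := by
      have := adj 2 (by omega)
      rw [h0]; rwa [hend] at this
    exact h.1 _ _ _ a0.symm a1 a2.symm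
  · rw [hl] at adj hend inj
    have a0 := adj 0 (by omega)
    have a1 := adj 1 (by omega)
    have a2 := adj 2 (by omega)
    have a3 : G.Adj (w.getVert 3) (w.getVert 0) := by
      have := adj 3 (by omega)
      rw [h0]; rwa [hend] at this
    have n02 : w.getVert 0 ≠ w.getVert 2 := fun e => by
      simpa using inj (by simp) (by simp) e
    have n13 : w.getVert 1 ≠ w.getVert 3 := fun e => by
      simpa using inj (by simp) (by simp) e
    exact n13 (h.2 _ _ n02 _ a0 a1.symm _ a3.symm a2)

namespace WindmillData

variable {V : Type*} {G : SimpleGraph V} (D : WindmillData G)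

/-- No new vertex lies on a triangle or 4-cycle, by a check at `u`, the hubs and their outer
neighbours. A short cycle thus has only old vertices; as no edge joins two tiles, it lies in one
copy of `G`. -/
theorem graph_noShortCycles (h : NoShortCycles G) : NoShortCycles D.graph := by
  have adj_u := fun w => (D.hasNeighbors_u).2.2.2 w
  have adj_c := fun i w => (D.hasNeighbors_c i).2.2.2 w
  have adj_a := fun i w => (D.hasNeighbors_a i).2.2.2 w
  have adj_b := fun i w => (D.hasNeighbors_b i).2.2.2 w
  have old_adj : ∀ i j v w hx hy hx' hy', D.graph.Adj (.old i v hx hy) (.old j w hx' hy') →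
      i = j ∧ G.Adj v w := by
    intro i j v w hx hy hx' hy' h
    simp only [graph, SimpleGraph.fromRel_adj, Rel] at h
    rcases h.2 with h | h
    exacts [h, ⟨h.1.symm, h.2.symm⟩]
  have ps : ∀ i : Fin 3, i - 1 ≠ i + 1 := pred_ne_succ
  have sp : ∀ i : Fin 3, i + 1 ≠ i - 1 := fun i => (pred_ne_succ i).symm
  constructor
  · have hu : ∀ p q, D.graph.Adj .u p → D.graph.Adj .u q → ¬ D.graph.Adj p q := by
      intro p q hp hq
      rcases (adj_u p).1 hp with rfl | rfl | rfl <;> rcases (adj_u q).1 hq with rfl | rfl | rfl <;>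
        simp [adj_c]
    have hc : ∀ i p q, D.graph.Adj (.c i) p → D.graph.Adj (.c i) q → ¬ D.graph.Adj p q := by
      intro i p q hp hq
      rcases (adj_c i p).1 hp with rfl | rfl | rfl <;>
        rcases (adj_c i q).1 hq with rfl | rfl | rfl <;> simp [adj_a, adj_b, adj_u, px, py]
    have ha : ∀ i p q, D.graph.Adj (.a i) p → D.graph.Adj (.a i) q → ¬ D.graph.Adj p q := by
      intro i p q hp hq
      rcases (adj_a i p).1 hp with rfl | rfl | rfl <;>
        rcases (adj_a i q).1 hq with rfl | rfl | rfl <;>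
        simp [graph, SimpleGraph.fromRel_adj, Rel, px, py, ps, sp]
    have hb : ∀ i p q, D.graph.Adj (.b i) p → D.graph.Adj (.b i) q → ¬ D.graph.Adj p q := by
      intro i p q hp hq
      rcases (adj_b i p).1 hp with rfl | rfl | rfl <;>
        rcases (adj_b i q).1 hq with rfl | rfl | rfl <;>
        simp [graph, SimpleGraph.fromRel_adj, Rel, px, py, ps, sp]
    have key : ∀ v p q, D.graph.Adj v p → D.graph.Adj v q → D.graph.Adj p q →
        ∃ i v' hx hy, v = .old i v' hx hy := by
      intro v p q h1 h2 h3
      cases v with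
      | old i v hx hy => exact ⟨i, v, hx, hy, rfl⟩
      | a i => exact absurd h3 (ha i _ _ h1 h2)
      | b i => exact absurd h3 (hb i _ _ h1 h2)
      | c i => exact absurd h3 (hc i _ _ h1 h2)
      | u => exact absurd h3 (hu _ _ h1 h2)
    intro v p q h1 h2 h3
    obtain ⟨i, v, hx, hy, rfl⟩ := key v p q h1 h2 h3
    obtain ⟨j, p, hx', hy', rfl⟩ := key p q _ h3 h1.symm h2.symm
    obtain ⟨k, q, hx'', hy'', rfl⟩ := key q _ _ h2.symm h3.symm h1
    exact h.1 v p q (old_adj _ _ _ _ _ _ _ _ h1).2 (old_adj _ _ _ _ _ _ _ _ h2).2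
      (old_adj _ _ _ _ _ _ _ _ h3).2
  · have hu : ∀ w p q, .u ≠ w → p ≠ q → D.graph.Adj .u p → D.graph.Adj w p →
        D.graph.Adj .u q → ¬ D.graph.Adj w q := by
      intro w p q hw hpq h1 h2 h3 h4
      rcases (adj_u p).1 h1 with rfl | rfl | rfl <;>
        rcases (adj_u q).1 h3 with rfl | rfl | rfl <;>
        rw [D.graph.adj_comm, adj_c] at h2 h4 <;> grind
    have hab : ∀ i w, .c i ≠ w → D.graph.Adj (.a i) w → ¬ D.graph.Adj (.b i) w := by
      intro i w hw h1 h2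
      have := D.nx_ne (i + 1)
      have := D.ny_ne (i - 1)
      rcases (adj_a i w).1 h1 with rfl | rfl | rfl <;>
        rcases (adj_b i _).1 h2 with h | h | h <;> simp_all [px, py]
    have hc : ∀ i w p q, .c i ≠ w → p ≠ q → D.graph.Adj (.c i) p → D.graph.Adj w p →
        D.graph.Adj (.c i) q → ¬ D.graph.Adj w q := by
      intro i w p q hw hpq h1 h2 h3 h4
      rcases (adj_c i p).1 h1 with rfl | rfl | rfl <;>
        rcases (adj_c i q).1 h3 with rfl | rfl | rfl
      · exact hpq rfl
      · exact hab i w hw h2.symm h4.symm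
      · exact hu _ _ _ hpq.symm hw h3.symm h1.symm h4.symm h2.symm
      · exact hab i w hw h4.symm h2.symm
      · exact hpq rfl
      · exact hu _ _ _ hpq.symm hw h3.symm h1.symm h4.symm h2.symm
      · exact hu _ _ _ hpq hw h1.symm h3.symm h2.symm h4.symm
      · exact hu _ _ _ hpq hw h1.symm h3.symm h2.symm h4.symm
      · exact hpq rfl
    -- Modulo 3, two different hubs lie between the same two tiles only with the roles of `x` and
    -- `y` not both exchanged.
    have idx : ∀ i j : Fin 3, i + 1 = j - 1 → i - 1 ≠ j + 1 := by decide
    have hpa : ∀ i w, .a i ≠ w → D.graph.Adj (D.px (i + 1) 0) w → ¬ D.graph.Adj (D.py (i - 1) 0) w := by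
      intro i w hw h1 h2
      cases w with
      | old j w hx hy =>
        exact sp i ((old_adj _ _ _ _ _ _ _ _ h1).1.trans (old_adj _ _ _ _ _ _ _ _ h2).1.symm)
      | a j =>
        rw [D.graph.adj_comm, adj_a] at h1 h2
        simp only [px, py, Vertex.old.injEq, reduceCtorEq, or_false, add_left_inj, sub_left_inj]
          at h1 h2
        rcases h1 with h1 | h1 <;> rcases h2 with h2 | h2
        · exact hw (by rw [h1.1])
        · exact hw (by rw [h1.1])
        · exact idx _ _ h1.1 h2.1
        · exact hw (by rw [h2.1])
      | b j =>
        have := D.nx_ne (i + 1)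
        have := D.ny_ne (i - 1)
        rw [D.graph.adj_comm, adj_b] at h1 h2
        simp only [px, py, Vertex.old.injEq, reduceCtorEq, or_false, add_left_inj, sub_left_inj]
          at h1 h2
        rcases h1 with ⟨rfl, h1⟩ | h1
        · contradiction
        rcases h2 with h2 | ⟨rfl, h2⟩
        · exact idx _ _ h1.1 h2.1
        · contradiction
      | c j => rw [D.graph.adj_comm, adj_c] at h1; simp [px] at h1
      | u => rw [D.graph.adj_comm, adj_u] at h1; simp [px] at h1
    have hpb : ∀ i w, .b i ≠ w → D.graph.Adj (D.px (i + 1) 1) w → ¬ D.graph.Adj (D.py (i - 1) 1) w := by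
      intro i w hw h1 h2
      cases w with
      | old j w hx hy =>
        exact sp i ((old_adj _ _ _ _ _ _ _ _ h1).1.trans (old_adj _ _ _ _ _ _ _ _ h2).1.symm)
      | b j =>
        rw [D.graph.adj_comm, adj_b] at h1 h2
        simp only [px, py, Vertex.old.injEq, reduceCtorEq, or_false, add_left_inj, sub_left_inj]
          at h1 h2
        rcases h1 with h1 | h1 <;> rcases h2 with h2 | h2
        · exact hw (by rw [h1.1])
        · exact hw (by rw [h1.1])
        · exact idx _ _ h1.1 h2.1
        · exact hw (by rw [h2.1])
      | a j =>
        have := (D.nx_ne (i + 1)).symm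
        have := (D.ny_ne (i - 1)).symm
        rw [D.graph.adj_comm, adj_a] at h1 h2
        simp only [px, py, Vertex.old.injEq, reduceCtorEq, or_false, add_left_inj, sub_left_inj]
          at h1 h2
        rcases h1 with ⟨rfl, h1⟩ | h1
        · contradiction
        rcases h2 with h2 | ⟨rfl, h2⟩
        · exact idx _ _ h1.1 h2.1
        · contradiction
      | c j => rw [D.graph.adj_comm, adj_c] at h1; simp [px] at h1
      | u => rw [D.graph.adj_comm, adj_u] at h1; simp [px] at h1
    have ha : ∀ i w p q, .a i ≠ w → p ≠ q → D.graph.Adj (.a i) p → D.graph.Adj w p →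
        D.graph.Adj (.a i) q → ¬ D.graph.Adj w q := by
      intro i w p q hw hpq h1 h2 h3 h4
      rcases (adj_a i p).1 h1 with rfl | rfl | rfl <;>
        rcases (adj_a i q).1 h3 with rfl | rfl | rfl
      · exact hpq rfl
      · exact hpa i w hw h2.symm h4.symm
      · exact hc _ _ _ _ hpq.symm hw h3.symm h1.symm h4.symm h2.symm
      · exact hpa i w hw h4.symm h2.symm
      · exact hpq rfl
      · exact hc _ _ _ _ hpq.symm hw h3.symm h1.symm h4.symm h2.symm
      · exact hc _ _ _ _ hpq hw h1.symm h3.symm h2.symm h4.symm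
      · exact hc _ _ _ _ hpq hw h1.symm h3.symm h2.symm h4.symm
      · exact hpq rfl
    have hb : ∀ i w p q, .b i ≠ w → p ≠ q → D.graph.Adj (.b i) p → D.graph.Adj w p →
        D.graph.Adj (.b i) q → ¬ D.graph.Adj w q := by
      intro i w p q hw hpq h1 h2 h3 h4
      rcases (adj_b i p).1 h1 with rfl | rfl | rfl <;>
        rcases (adj_b i q).1 h3 with rfl | rfl | rfl
      · exact hpq rfl
      · exact hpb i w hw h2.symm h4.symm
      · exact hc _ _ _ _ hpq.symm hw h3.symm h1.symm h4.symm h2.symm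
      · exact hpb i w hw h4.symm h2.symm
      · exact hpq rfl
      · exact hc _ _ _ _ hpq.symm hw h3.symm h1.symm h4.symm h2.symm
      · exact hc _ _ _ _ hpq hw h1.symm h3.symm h2.symm h4.symm
      · exact hc _ _ _ _ hpq hw h1.symm h3.symm h2.symm h4.symm
      · exact hpq rfl
    have key : ∀ v w p q, v ≠ w → p ≠ q → D.graph.Adj v p → D.graph.Adj w p → D.graph.Adj v q →
        D.graph.Adj w q → ∃ i v' hx hy, v = .old i v' hx hy := by
      intro v w p q h1 h2 h3 h4 h5 h6
      cases v with
      | old i v hx hy => exact ⟨i, v, hx, hy, rfl⟩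
      | a i => exact absurd h6 (ha i _ _ _ h1 h2 h3 h4 h5)
      | b i => exact absurd h6 (hb i _ _ _ h1 h2 h3 h4 h5)
      | c i => exact absurd h6 (hc i _ _ _ h1 h2 h3 h4 h5)
      | u => exact absurd h6 (hu _ _ _ h1 h2 h3 h4 h5)
    intro v w hvw p h1 h2 q h3 h4
    by_contra hpq
    obtain ⟨i, v, hx, hy, rfl⟩ := key v w p q hvw hpq h1 h2 h3 h4
    obtain ⟨i', w, hx', hy', rfl⟩ := key w _ p q hvw.symm hpq h2 h1 h4 h3
    obtain ⟨j, p, kx, ky, rfl⟩ := key p q _ _ hpq hvw h1.symm h3.symm h2.symm h4.symm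
    obtain ⟨j', q, kx', ky', rfl⟩ := key q _ _ _ (Ne.symm hpq) hvw h3.symm h1.symm h4.symm h2.symm
    obtain ⟨rfl, e1⟩ := old_adj _ _ _ _ _ _ _ _ h1
    obtain ⟨rfl, e2⟩ := old_adj _ _ _ _ _ _ _ _ h2
    obtain ⟨rfl, e3⟩ := old_adj _ _ _ _ _ _ _ _ h3
    have e4 := (old_adj _ _ _ _ _ _ _ _ h4).2
    refine hpq ?_
    simpa using h.2 v w (fun e => hvw (by simpa using e)) p e1 e2 q e3 e4

end WindmillData

/-! ### Edge cuts with fewer than four edges. -/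

/-- `0` or `1` according to whether two Booleans are equal or not. -/
def bdist (p q : Bool) : ℕ := if p = q then 0 else 1

open Classical in
/-- The number of neighbours of `v` in the other class of `χ`. -/
noncomputable def cutRow {V : Type*} [Fintype V] (G : SimpleGraph V) (χ : V → Bool) (v : V) : ℕ :=
  ∑ w, if G.Adj v w then bdist (χ v) (χ w) else 0

/-- Twice the number of edges between the two classes of `χ`. -/
noncomputable def cutDegree {V : Type*} [Fintype V] (G : SimpleGraph V) (χ : V → Bool) : ℕ :=
  ∑ v, cutRow G χ v

/-- Every edge cut with fewer than four edges has at most one vertex on one of its sides. -/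
def IsEssentiallyFourConnected {V : Type*} [Fintype V] (G : SimpleGraph V) : Prop :=
  ∀ χ : V → Bool, cutDegree G χ < 8 → ∃ z β, ∀ v, v ≠ z → χ v = β

theorem bdist_comm (p q : Bool) : bdist p q = bdist q p := by revert p q; decide

section Cut

variable {V : Type*} [Fintype V] {G : SimpleGraph V}

theorem HasNeighbors.cutRow {v p q r : V} (h : HasNeighbors G v p q r) (χ : V → Bool) :
    cutRow G χ v = bdist (χ v) (χ p) + bdist (χ v) (χ q) + bdist (χ v) (χ r) := by
  classical
  rw [_root_.cutRow, ← h.sum fun w => bdist (χ v) (χ w)]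

/-- A single vertex alone on its side of a cut has three cut edges, which contribute 6 to the
doubled count. -/
theorem IsEssentiallyFourConnected.const_of_lt (h : IsEssentiallyFourConnected G) (hG : IsCubic G)
    {χ : V → Bool} (hχ : cutDegree G χ < 6) : ∃ β, ∀ v, χ v = β := by
  classical
  obtain ⟨z, β, hz⟩ := h χ (by omega)
  refine ⟨β, fun v => ?_⟩
  by_cases hv : v = z
  swap
  · exact hz v hv
  subst hv
  by_contra hne
  obtain ⟨p, q, r, hn⟩ := hG v
  have hb : ∀ w, w ≠ v → bdist (χ v) (χ w) = 1 := fun w hw => by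
    rw [hz w hw, bdist, if_neg hne]
  have h1 : ∀ w, G.Adj v w → 1 ≤ cutRow G χ w := by
    intro w hw
    calc 1 = if G.Adj w v then bdist (χ w) (χ v) else 0 := by
            rw [if_pos hw.symm, bdist_comm, hb w hw.ne']
      _ ≤ _ := by
            rw [cutRow]
            exact Finset.single_le_sum (f := fun x => if G.Adj w x then bdist (χ w) (χ x) else 0)
              (fun _ _ => Nat.zero_le _) (Finset.mem_univ v)
  have hle : ∑ w ∈ {v, p, q, r}, cutRow G χ w ≤ cutDegree G χ :=
    Finset.sum_le_univ_sum_of_nonneg fun _ => Nat.zero_le _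
  have ap := hn.adj
  have aq := hn.rotate.adj
  have ar := hn.rotate.rotate.adj
  rw [Finset.sum_insert (by simp [ap.ne, aq.ne, ar.ne]),
    Finset.sum_insert (by simp [hn.1, hn.2.1]), Finset.sum_insert (by simp [hn.2.2.1]),
    Finset.sum_singleton, hn.cutRow, hb _ ap.ne', hb _ aq.ne', hb _ ar.ne'] at hle
  have := h1 p ap
  have := h1 q aq
  have := h1 r ar
  omega

theorem cutDegree_eq_two_mul_ncard (X : Set V) [DecidablePred (· ∈ X)] :
    cutDegree G (fun v => decide (v ∈ X)) = 2 * (edgeCut G X).ncard := by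
  classical
  let H : SimpleGraph V :=
    { Adj := fun v w => G.Adj v w ∧ ¬ (v ∈ X ↔ w ∈ X)
      symm := ⟨fun v w h => ⟨h.1.symm, fun e => h.2 e.symm⟩⟩
      loopless := ⟨fun v h => h.1.ne rfl⟩ }
  have hE : H.edgeSet = edgeCut G X := by
    ext e
    induction e using Sym2.inductionOn with
    | hf v w =>
      simp only [SimpleGraph.mem_edgeSet, edgeCut, Set.mem_ofPred_eq, H]
      constructor
      · rintro ⟨h1, h2⟩
        by_cases hv : v ∈ X
        · exact ⟨v, hv, w, by tauto, h1, rfl⟩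
        · exact ⟨w, by tauto, v, hv, h1.symm, Sym2.eq_swap⟩
      · rintro ⟨a, ha, b, hb, hab, he⟩
        rcases Sym2.eq_iff.1 he with ⟨rfl, rfl⟩ | ⟨rfl, rfl⟩
        exacts [⟨hab, by tauto⟩, ⟨hab.symm, by tauto⟩]
  rw [← hE, Set.ncard_eq_toFinset_card', ← SimpleGraph.edgeFinset,
    ← H.sum_degrees_eq_twice_card_edges, cutDegree]
  refine Finset.sum_congr rfl fun v _ => ?_
  rw [cutRow, ← SimpleGraph.card_neighborFinset_eq_degree, SimpleGraph.neighborFinset_eq_filter,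
    Finset.card_filter]
  refine Finset.sum_congr rfl fun w _ => ?_
  simp only [bdist, H]
  by_cases hv : v ∈ X <;> by_cases hw : w ∈ X <;> simp [hv, hw]

/-- A side with at most one vertex contains no cycle. -/
theorem IsEssentiallyFourConnected.isCyclicallyEdgeConnected (h : IsEssentiallyFourConnected G) :
    IsCyclicallyEdgeConnected G 4 := by
  classical
  intro X h1 h2
  by_contra! hlt
  obtain ⟨z, β, hz⟩ := h (fun v => decide (v ∈ X)) (by rw [cutDegree_eq_two_mul_ncard]; omega)
  have acyc : ∀ Y : Set V, (∀ v ∈ Y, v = z) → (G.induce Y).IsAcyclic := by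
    intro Y hY
    have : Subsingleton Y := ⟨fun a b => Subtype.ext ((hY _ a.2).trans (hY _ b.2).symm)⟩
    exact SimpleGraph.IsAcyclic.of_subsingleton
  cases β
  · exact h1 (acyc _ fun v hv => by by_contra hne; simpa [hv] using hz v hne)
  · exact h2 (acyc _ fun v hv => by by_contra hne; exact hv (by simpa using hz v hne))

/-- The vertices reachable from `v` define a cut without edges. -/
theorem IsEssentiallyFourConnected.connected [Nonempty V] (h : IsEssentiallyFourConnected G)
    (hG : IsCubic G) : G.Connected := by
  classical
  refine ⟨fun v w => ?_⟩
  obtain ⟨β, hβ⟩ := h.const_of_lt hG (χ := fun w => decide (G.Reachable v w)) (by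
    rw [cutDegree, Finset.sum_eq_zero]
    · norm_num
    · intro a _
      rw [cutRow]
      refine Finset.sum_eq_zero fun b _ => ?_
      split_ifs with hab
      · have : G.Reachable v a ↔ G.Reachable v b :=
          ⟨fun h => h.trans hab.reachable, fun h => h.trans hab.symm.reachable⟩
        simp [bdist, this]
      · rfl)
  have h1 := hβ v
  have h2 := hβ w
  rw [← h1] at h2
  simpa using h2

end Cut

theorem petersen_cut_arith : ∀ o₀ o₁ o₂ o₃ o₄ n₀ n₁ n₂ n₃ n₄ : Bool,
    bdist o₀ o₁ + bdist o₁ o₂ + bdist o₂ o₃ + bdist o₃ o₄ + bdist o₄ o₀ +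
      (bdist n₀ n₂ + bdist n₂ n₄ + bdist n₄ n₁ + bdist n₁ n₃ + bdist n₃ n₀) +
      (bdist o₀ n₀ + bdist o₁ n₁ + bdist o₂ n₂ + bdist o₃ n₃ + bdist o₄ n₄) < 4 →
    ∃ β, bdist o₀ β + bdist o₁ β + bdist o₂ β + bdist o₃ β + bdist o₄ β +
      (bdist n₀ β + bdist n₁ β + bdist n₂ β + bdist n₃ β + bdist n₄ β) < 2 := by
  decide +kernel

theorem petersen_isEssentiallyFourConnected : IsEssentiallyFourConnected petersenGraph := by
  intro χ hχ
  rw [cutDegree, Fintype.sum_prod_type, Fintype.sum_bool, Fin.sum_univ_five, Fin.sum_univ_five,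
    (hasNeighbors_petersen_outer 0).cutRow, (hasNeighbors_petersen_outer 1).cutRow,
    (hasNeighbors_petersen_outer 2).cutRow, (hasNeighbors_petersen_outer 3).cutRow,
    (hasNeighbors_petersen_outer 4).cutRow, (hasNeighbors_petersen_inner 0).cutRow,
    (hasNeighbors_petersen_inner 1).cutRow, (hasNeighbors_petersen_inner 2).cutRow,
    (hasNeighbors_petersen_inner 3).cutRow, (hasNeighbors_petersen_inner 4).cutRow] at hχ
  obtain ⟨β, hβ⟩ := petersen_cut_arith (χ (false, 0)) (χ (false, 1)) (χ (false, 2)) (χ (false, 3))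
    (χ (false, 4)) (χ (true, 0)) (χ (true, 1)) (χ (true, 2)) (χ (true, 3)) (χ (true, 4)) (by
      simp only [Fin.reduceSub, Fin.reduceAdd, Fin.isValue, zero_add, sub_self] at hχ
      have c := bdist_comm
      have := c (χ (false, 0)) (χ (false, 1))
      have := c (χ (false, 1)) (χ (false, 2))
      have := c (χ (false, 2)) (χ (false, 3))
      have := c (χ (false, 3)) (χ (false, 4))
      have := c (χ (false, 4)) (χ (false, 0))
      have := c (χ (true, 0)) (χ (true, 2))
      have := c (χ (true, 2)) (χ (true, 4))
      have := c (χ (true, 4)) (χ (true, 1))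
      have := c (χ (true, 1)) (χ (true, 3))
      have := c (χ (true, 3)) (χ (true, 0))
      have := c (χ (false, 0)) (χ (true, 0))
      have := c (χ (false, 1)) (χ (true, 1))
      have := c (χ (false, 2)) (χ (true, 2))
      have := c (χ (false, 3)) (χ (true, 3))
      have := c (χ (false, 4)) (χ (true, 4))
      omega)
  by_cases h : ∃ z, χ z ≠ β
  swap
  · push Not at h
    exact ⟨(false, 0), β, fun v _ => h v⟩
  obtain ⟨z, hz⟩ := h
  refine ⟨z, β, fun v hv => ?_⟩
  by_contra hne
  have : 2 ≤ ∑ w, bdist (χ w) β := by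
    calc 2 = ∑ w ∈ {v, z}, bdist (χ w) β := by
            rw [Finset.sum_pair hv, bdist, bdist, if_neg hne, if_neg hz]
      _ ≤ _ := Finset.sum_le_univ_sum_of_nonneg fun _ => Nat.zero_le _
  rw [Fintype.sum_prod_type, Fintype.sum_bool, Fin.sum_univ_five, Fin.sum_univ_five] at this
  omega

/-- A lower bound for the number of cut edges at a tile, given the sides `p`, `q`, `r`, `s` of the
outer ends of its four outgoing edges; the tile lies in one class (`some t`) or meets both
(`none`). -/
def tileCut : Option Bool → Bool → Bool → ℕ
  | some t, p, q => bdist t p + bdist t q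
  | none, p, q => 1 - bdist p q

/-- A tile meeting both classes costs one cut edge, plus one for each of its two outer pairs that is
monochromatic. -/
def tileBase : Option Bool → ℕ
  | some _ => 0
  | none => 1

/-- The contribution of a hub `{a, b, c}` between two tiles to the lower bound for a cut. -/
def hubCut (s s' : Option Bool) (u a b c : Bool) : ℕ :=
  bdist c a + bdist c b + bdist c u + tileCut s a b + tileCut s' a b

/-- This table and the next ones give the cheapest colourings of a hub, according to the classes of
the two adjacent tiles and of `u`. -/
theorem hubCut_same : ∀ t a b c : Bool, (a = t ∧ b = t ∧ c = t) ∨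
    3 ≤ hubCut (some t) (some t) t a b c ∧ (hubCut (some t) (some t) t a b c < 4 →
      (b = t ∧ c = t) ∨ (a = t ∧ c = t) ∨ (a = t ∧ b = t)) := by decide

theorem hubCut_ne : ∀ t t' u a b c : Bool, t ≠ t' → 2 ≤ hubCut (some t) (some t') u a b c := by
  decide

theorem hubCut_u : ∀ t u a b c : Bool, t ≠ u → 1 ≤ hubCut (some t) (some t) u a b c ∧
    (hubCut (some t) (some t) u a b c < 2 → a = t ∧ b = t ∧ c = t) := by decide

theorem hubCut_none_right : ∀ t u a b c : Bool, 1 ≤ hubCut (some t) none u a b c ∧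
    (hubCut (some t) none u a b c < 2 → t = u ∧ a = t ∧ b = t ∧ c = t) := by decide

theorem hubCut_none_left : ∀ t u a b c : Bool, 1 ≤ hubCut none (some t) u a b c ∧
    (hubCut none (some t) u a b c < 2 → t = u ∧ a = t ∧ b = t ∧ c = t) := by decide

theorem hubCut_none_none : ∀ u a b c : Bool, 1 ≤ hubCut none none u a b c := by decide

/-- The possible configurations of a cut with fewer than four edges. -/
theorem windmill_cut_arith (s : Fin 3 → Option Bool) (a b c : Fin 3 → Bool) (u : Bool)
    (h : ∑ i, (tileBase (s i) + hubCut (s (i + 1)) (s (i - 1)) u (a i) (b i) (c i)) < 4) :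
    ∃ β, ((∀ i, s i = some β) ∧ ((∀ i, a i = β ∧ b i = β ∧ c i = β) ∨ (u = β ∧ ∃ j,
        (∀ i, i ≠ j → a i = β ∧ b i = β ∧ c i = β) ∧
        ((b j = β ∧ c j = β) ∨ (a j = β ∧ c j = β) ∨ (a j = β ∧ b j = β))))) ∨
      ∃ j, s j = none ∧ (∀ i, i ≠ j → s i = some β) ∧ u = β ∧
        ∀ i, a i = β ∧ b i = β ∧ c i = β := by
  rw [Fin.sum_univ_three] at h
  simp only [Fin.reduceSub, Fin.reduceAdd, Fin.isValue, zero_add, sub_self] at h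
  -- Two mixed tiles already cost four edges. One mixed tile leaves no room for any other cut edge,
  -- and tiles in different classes cost too much.
  rcases hs0 : s 0 with _ | t0 <;> rcases hs1 : s 1 with _ | t1 <;>
    rcases hs2 : s 2 with _ | t2 <;> simp only [hs0, hs1, hs2, tileBase] at h
  · have := hubCut_none_none u (a 0) (b 0) (c 0)
    omega
  · have := hubCut_none_left t2 u (a 0) (b 0) (c 0)
    have := hubCut_none_right t2 u (a 1) (b 1) (c 1)
    have := hubCut_none_none u (a 2) (b 2) (c 2)
    omega
  · have := hubCut_none_right t1 u (a 0) (b 0) (c 0)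
    have := hubCut_none_none u (a 1) (b 1) (c 1)
    have := hubCut_none_left t1 u (a 2) (b 2) (c 2)
    omega
  · obtain ⟨h1, h1'⟩ := hubCut_none_right t2 u (a 1) (b 1) (c 1)
    obtain ⟨h2, h2'⟩ := hubCut_none_left t1 u (a 2) (b 2) (c 2)
    obtain ⟨rfl, e1⟩ := h1' (by omega)
    obtain ⟨rfl, e2⟩ := h2' (by omega)
    have e0 := (hubCut_same t1 (a 0) (b 0) (c 0)).resolve_right (by omega)
    refine ⟨t1, Or.inr ⟨0, hs0, ?_, rfl, ?_⟩⟩ <;> simp [Fin.forall_fin_succ, *]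
  · have := hubCut_none_none u (a 0) (b 0) (c 0)
    have := hubCut_none_left t0 u (a 1) (b 1) (c 1)
    have := hubCut_none_right t0 u (a 2) (b 2) (c 2)
    omega
  · obtain ⟨h0, h0'⟩ := hubCut_none_left t2 u (a 0) (b 0) (c 0)
    obtain ⟨h2, h2'⟩ := hubCut_none_right t0 u (a 2) (b 2) (c 2)
    obtain ⟨rfl, e0⟩ := h0' (by omega)
    obtain ⟨rfl, e2⟩ := h2' (by omega)
    have e1 := (hubCut_same t0 (a 1) (b 1) (c 1)).resolve_right (by omega)
    refine ⟨t0, Or.inr ⟨1, hs1, ?_, rfl, ?_⟩⟩ <;> simp [Fin.forall_fin_succ, *]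
  · obtain ⟨h0, h0'⟩ := hubCut_none_right t1 u (a 0) (b 0) (c 0)
    obtain ⟨h1, h1'⟩ := hubCut_none_left t0 u (a 1) (b 1) (c 1)
    obtain ⟨rfl, e0⟩ := h0' (by omega)
    obtain ⟨rfl, e1⟩ := h1' (by omega)
    have e2 := (hubCut_same t0 (a 2) (b 2) (c 2)).resolve_right (by omega)
    refine ⟨t0, Or.inr ⟨2, hs2, ?_, rfl, ?_⟩⟩ <;> simp [Fin.forall_fin_succ, *]
  · have n0 := hubCut_ne t1 t2 u (a 0) (b 0) (c 0)
    have n1 := hubCut_ne t2 t0 u (a 1) (b 1) (c 1)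
    have n2 := hubCut_ne t0 t1 u (a 2) (b 2) (c 2)
    have e : t0 = t1 ∧ t1 = t2 := by
      clear hs0 hs1 hs2
      cases t0 <;> cases t1 <;> cases t2 <;>
        simp only [ne_eq, reduceCtorEq, not_false_eq_true, forall_true_left, not_true_eq_false,
          and_self] at n0 n1 n2 ⊢ <;> omega
    obtain ⟨rfl, rfl⟩ := e
    refine ⟨t0, Or.inl ⟨by simp [Fin.forall_fin_succ, *], ?_⟩⟩
    by_cases hu : t0 = u
    · subst hu
      have h0 := hubCut_same t0 (a 0) (b 0) (c 0)
      have h1 := hubCut_same t0 (a 1) (b 1) (c 1)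
      have h2 := hubCut_same t0 (a 2) (b 2) (c 2)
      rcases h0 with h0 | ⟨h0, h0'⟩
      · rcases h1 with h1 | ⟨h1, h1'⟩
        · rcases h2 with h2 | ⟨h2, h2'⟩
          · left; simp [Fin.forall_fin_succ, *]
          · exact Or.inr ⟨rfl, 2, by simp [Fin.forall_fin_succ, *], h2' (by omega)⟩
        · have := h2.resolve_right (by omega)
          exact Or.inr ⟨rfl, 1, by simp [Fin.forall_fin_succ, *], h1' (by omega)⟩
      · have := h1.resolve_right (by omega)
        have := h2.resolve_right (by omega)
        exact Or.inr ⟨rfl, 0, by simp [Fin.forall_fin_succ, *], h0' (by omega)⟩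
    · obtain ⟨h0, h0'⟩ := hubCut_u t0 u (a 0) (b 0) (c 0) hu
      obtain ⟨h1, h1'⟩ := hubCut_u t0 u (a 1) (b 1) (c 1) hu
      obtain ⟨h2, h2'⟩ := hubCut_u t0 u (a 2) (b 2) (c 2) hu
      have := h0' (by omega)
      have := h1' (by omega)
      have := h2' (by omega)
      left; simp [Fin.forall_fin_succ, *]

/-- The number of cut edges at a tile that meets both classes. -/
theorem mixed_tile_arith {I : ℕ} {x₀ x₁ y₀ y₁ : Bool}
    (h : ∀ ξ η, (if ξ = η then 6 else 8) ≤ I + 2 * (bdist x₀ ξ + bdist x₁ ξ + bdist y₀ η +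
      bdist y₁ η + bdist ξ η)) (p q r s : Bool) :
    2 * (1 + (1 - bdist p q) + (1 - bdist r s)) ≤
      I + 2 * (bdist x₀ p + bdist x₁ q + bdist y₀ r + bdist y₁ s) := by
  -- When each outer pair is monochromatic, `h` leaves three cut edges after discounting the deleted
  -- edge. Recolouring one outer end changes the count by at most one.
  have hf : ∀ x, bdist x false = 1 - bdist x true := by decide
  have hl : ∀ x, bdist x true ≤ 1 := by decide
  have htt : bdist true true = 0 := rfl
  have hft : bdist false true = 1 := rfl
  have h1 := h true true
  have h2 := h true false
  have h3 := h false true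
  have h4 := h false false
  have := hl x₀
  have := hl x₁
  have := hl y₀
  have := hl y₁
  cases p <;> cases q <;> cases r <;> cases s <;>
    simp only [hf, htt, hft, if_true, reduceCtorEq, if_false] at h1 h2 h3 h4 ⊢ <;> omega

/-! ### Small cuts of the windmill graph. -/

namespace WindmillData

variable {V : Type*} {G : SimpleGraph V} (D : WindmillData G)

/-- The vertices of the windmill graph as a disjoint union. -/
def vertexEquiv : D.Vertex ≃
    (Σ i : Fin 3, {v : V // v ≠ D.x i ∧ v ≠ D.y i}) ⊕ (Fin 3 ⊕ Fin 3 ⊕ Fin 3 ⊕ Unit) where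
  toFun
    | .old i v hx hy => .inl ⟨i, v, hx, hy⟩
    | .a i => .inr (.inl i)
    | .b i => .inr (.inr (.inl i))
    | .c i => .inr (.inr (.inr (.inl i)))
    | .u => .inr (.inr (.inr (.inr ())))
  invFun
    | .inl ⟨i, v, h⟩ => .old i v h.1 h.2
    | .inr (.inl i) => .a i
    | .inr (.inr (.inl i)) => .b i
    | .inr (.inr (.inr (.inl i))) => .c i
    | .inr (.inr (.inr (.inr ()))) => .u
  left_inv v := by cases v <;> rfl
  right_inv v := by
    rcases v with ⟨i, v, h⟩ | i | i | i | i <;> rfl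

instance [Finite V] : Finite D.Vertex := Finite.of_equiv _ D.vertexEquiv.symm

instance : Nonempty D.Vertex := ⟨.u⟩

open Classical in
theorem sum_vertex [Fintype V] [Fintype D.Vertex] {M : Type*} [AddCommMonoid M]
    (f : D.Vertex → M) :
    ∑ v, f v = ∑ i, ∑ v : {v : V // v ≠ D.x i ∧ v ≠ D.y i}, f (.old i v v.2.1 v.2.2) +
      (∑ i, f (.a i) + (∑ i, f (.b i) + (∑ i, f (.c i) + f .u))) := by
  rw [← D.vertexEquiv.symm.sum_comp]
  simp only [Fintype.sum_sum_type, Fintype.sum_sigma]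
  simp [vertexEquiv]

open Classical in
theorem sum_tile [Fintype V] {M : Type*} [AddCommMonoid M] (i : Fin 3) (f : V → M) :
    ∑ v, f v = ∑ v : {v : V // v ≠ D.x i ∧ v ≠ D.y i}, f v + f (D.x i) + f (D.y i) := by
  rw [← Finset.sum_subtype (Finset.univ.filter fun v => v ≠ D.x i ∧ v ≠ D.y i) (by simp) f,
    Finset.sum_filter]
  have h : ∀ v, f v = (if v ≠ D.x i ∧ v ≠ D.y i then f v else 0) + (if v = D.x i then f v else 0) +
      (if v = D.y i then f v else 0) := by
    intro v
    have := D.x_ne_y i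
    by_cases hx : v = D.x i
    · subst hx; simp [this]
    · by_cases hy : v = D.y i
      · subst hy; simp [this.symm]
      · simp [hx, hy]
  conv_lhs => rw [Finset.sum_congr rfl fun v _ => h v]
  simp [Finset.sum_add_distrib]

theorem natCard_vertex [Finite V] (n : ℕ) (h : Nat.card V = n + 2) :
    Nat.card D.Vertex = 3 * n + 10 := by
  classical
  have := Fintype.ofFinite V
  have := Fintype.ofFinite D.Vertex
  rw [Nat.card_eq_fintype_card] at h ⊢
  have key : ∀ i, ∑ v : {v : V // v ≠ D.x i ∧ v ≠ D.y i}, 1 = n := by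
    intro i
    have := D.sum_tile i (fun _ => 1)
    simp only [Finset.sum_const, Finset.card_univ, h, smul_eq_mul, mul_one] at this ⊢
    omega
  have := D.sum_vertex (fun _ => 1)
  rw [Finset.sum_congr rfl fun i _ => key i] at this
  simp at this
  omega

open Classical in
/-- The colouring of the `i`-th copy of `G` that extends `χ` by `ξ` on `x_i` and `η` on `y_i`. -/
noncomputable def extend (i : Fin 3) (χ : D.Vertex → Bool) (ξ η : Bool) (v : V) : Bool :=
  if h : v ≠ D.x i ∧ v ≠ D.y i then χ (.old i v h.1 h.2) else if v = D.x i then ξ else η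

@[simp] theorem extend_x (i : Fin 3) (χ : D.Vertex → Bool) (ξ η : Bool) :
    D.extend i χ ξ η (D.x i) = ξ := by simp [extend]

@[simp] theorem extend_y (i : Fin 3) (χ : D.Vertex → Bool) (ξ η : Bool) :
    D.extend i χ ξ η (D.y i) = η := by simp [extend, (D.x_ne_y i).symm]

theorem extend_old (i : Fin 3) (χ : D.Vertex → Bool) (ξ η : Bool) {v : V} (hx : v ≠ D.x i)
    (hy : v ≠ D.y i) : D.extend i χ ξ η v = χ (.old i v hx hy) := by simp [extend, hx, hy]

@[simp] theorem extend_nx (i : Fin 3) (χ : D.Vertex → Bool) (ξ η : Bool) (k : Fin 2) :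
    D.extend i χ ξ η (D.nx i k) = χ (D.px i k) := D.extend_old i χ ξ η _ _

@[simp] theorem extend_ny (i : Fin 3) (χ : D.Vertex → Bool) (ξ η : Bool) (k : Fin 2) :
    D.extend i χ ξ η (D.ny i k) = χ (D.py i k) := D.extend_old i χ ξ η _ _

open Classical in
theorem sum_tile_adj [Fintype V] (i : Fin 3) (g : V → V → ℕ) :
    ∑ v : {v : V // v ≠ D.x i ∧ v ≠ D.y i}, ∑ w, (if G.Adj v w then g v w else 0) =
      ∑ v : {v : V // v ≠ D.x i ∧ v ≠ D.y i}, ∑ w : {v : V // v ≠ D.x i ∧ v ≠ D.y i},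
        (if G.Adj v w then g v w else 0) +
      (g (D.nx i 0) (D.x i) + g (D.nx i 1) (D.x i) + g (D.ny i 0) (D.y i) +
        g (D.ny i 1) (D.y i)) := by
  have hx := D.sum_tile i fun v => if G.Adj (D.x i) v then g v (D.x i) else 0
  have hy := D.sum_tile i fun v => if G.Adj (D.y i) v then g v (D.y i) else 0
  rw [(D.hasNeighbors_x i).sum fun v => g v (D.x i)] at hx
  rw [(D.hasNeighbors_y i).sum fun v => g v (D.y i)] at hy
  simp only [D.adj i, (D.adj i).symm, SimpleGraph.irrefl, if_true, if_false, add_zero,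
    G.adj_comm (D.x i), G.adj_comm (D.y i)] at hx hy
  simp_rw [D.sum_tile i]
  rw [Finset.sum_add_distrib, Finset.sum_add_distrib]
  omega

open Classical in
/-- The number of ordered pairs of adjacent vertices of a tile in different classes. -/
noncomputable def innerCut [Fintype V] (i : Fin 3) (χ : D.Vertex → Bool) : ℕ :=
  ∑ v : {v : V // v ≠ D.x i ∧ v ≠ D.y i}, ∑ w : {v : V // v ≠ D.x i ∧ v ≠ D.y i},
    if G.Adj v w then bdist (χ (.old i v v.2.1 v.2.2)) (χ (.old i w w.2.1 w.2.2)) else 0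

open Classical in
theorem sum_cutRow_old [Fintype V] [Fintype D.Vertex] (hG : IsCubic G) (i : Fin 3)
    (χ : D.Vertex → Bool) :
    ∑ v : {v : V // v ≠ D.x i ∧ v ≠ D.y i}, cutRow D.graph χ (.old i v v.2.1 v.2.2) =
      D.innerCut i χ + (bdist (χ (D.px i 0)) (χ (.a (i - 1))) +
        bdist (χ (D.px i 1)) (χ (.b (i - 1))) + bdist (χ (D.py i 0)) (χ (.a (i + 1))) +
        bdist (χ (D.py i 1)) (χ (.b (i + 1)))) := by
  have h := D.sum_tile_adj i fun v w => bdist (D.extend i χ true true v) (χ (D.out i v w))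
  simp only [out_nx_zero, out_nx_one, out_ny_zero, out_ny_one, extend_nx, extend_ny] at h
  rw [innerCut]
  convert h using 1
  · refine Finset.sum_congr rfl fun v _ => ?_
    obtain ⟨p, q, r, hn⟩ := hG v
    rw [hn.sum, (D.hasNeighbors_old i v.2.1 v.2.2 hn).cutRow, D.extend_old i χ _ _ v.2.1 v.2.2]
  · congr 1
    refine Finset.sum_congr rfl fun v _ => Finset.sum_congr rfl fun w _ => ?_
    rw [D.extend_old i χ _ _ v.2.1 v.2.2, D.out_old i v w.2.1 w.2.2]

theorem cutDegree_extend [Fintype V] (i : Fin 3) (χ : D.Vertex → Bool) (ξ η : Bool) :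
    cutDegree G (D.extend i χ ξ η) = D.innerCut i χ + 2 * (bdist (χ (D.px i 0)) ξ +
      bdist (χ (D.px i 1)) ξ + bdist (χ (D.py i 0)) η + bdist (χ (D.py i 1)) η + bdist ξ η) := by
  classical
  have h := D.sum_tile_adj i fun v w => bdist (D.extend i χ ξ η v) (D.extend i χ ξ η w)
  simp only [extend_nx, extend_ny, extend_x, extend_y] at h
  rw [cutDegree, D.sum_tile i, (D.hasNeighbors_x i).cutRow, (D.hasNeighbors_y i).cutRow]
  simp only [cutRow, extend_nx, extend_ny, extend_x, extend_y]
  rw [h, innerCut]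
  have : ∀ v w : {v : V // v ≠ D.x i ∧ v ≠ D.y i},
      bdist (D.extend i χ ξ η v) (D.extend i χ ξ η w) =
        bdist (χ (.old i v v.2.1 v.2.2)) (χ (.old i w w.2.1 w.2.2)) := fun v w => by
    rw [D.extend_old i χ _ _ v.2.1 v.2.2, D.extend_old i χ _ _ w.2.1 w.2.2]
  simp only [this]
  rw [bdist_comm η ξ, bdist_comm ξ (χ _), bdist_comm ξ (χ _), bdist_comm η (χ _),
    bdist_comm η (χ _)]
  omega

/-- Each tile is completed to a copy of `G` by colouring `x_i` and `y_i`; the hypothesis on `G`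
bounds its cut edges from below, and `windmill_cut_arith` combines the bounds. -/
theorem graph_isEssentiallyFourConnected [Fintype V] [Fintype D.Vertex] (hG : IsCubic G)
    (h : IsEssentiallyFourConnected G) : IsEssentiallyFourConnected D.graph := by
  classical
  intro χ hχ
  have hs : ∀ i, ∃ s : Option Bool, (∀ t, s = some t → ∀ v hx hy, χ (.old i v hx hy) = t) ∧
      (s = none → ∀ t, ∃ v hx hy, χ (.old i v hx hy) ≠ t) := by
    intro i
    by_cases hc : ∃ t, ∀ v hx hy, χ (.old i v hx hy) = t
    · obtain ⟨t, ht⟩ := hc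
      refine ⟨some t, ?_, by simp⟩
      rintro _ ⟨⟩
      exact ht
    · push Not at hc
      exact ⟨none, by simp, fun _ => hc⟩
  choose s hsome hnone using hs
  have tile : ∀ i, 2 * (tileBase (s i) + tileCut (s i) (χ (.a (i - 1))) (χ (.b (i - 1))) +
      tileCut (s i) (χ (.a (i + 1))) (χ (.b (i + 1)))) ≤ D.innerCut i χ +
      2 * (bdist (χ (D.px i 0)) (χ (.a (i - 1))) + bdist (χ (D.px i 1)) (χ (.b (i - 1))) +
        bdist (χ (D.py i 0)) (χ (.a (i + 1))) + bdist (χ (D.py i 1)) (χ (.b (i + 1)))) := by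
    intro i
    rcases hsi : s i with _ | t
    · refine mixed_tile_arith (fun ξ η => ?_) _ _ _ _
      rw [← cutDegree_extend]
      by_contra hlt
      obtain ⟨β, hβ⟩ : ∃ β, ∀ v hx hy, χ (.old i v hx hy) = β := by
        split_ifs at hlt with hξ
        · obtain ⟨β, hβ⟩ := h.const_of_lt hG (not_le.1 hlt)
          exact ⟨β, fun v hx hy => by rw [← hβ v, D.extend_old]⟩
        · obtain ⟨z, β, hβ⟩ := h _ (not_le.1 hlt)
          refine ⟨β, fun v hx hy => ?_⟩
          rw [← hβ v, D.extend_old]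
          rintro rfl
          have h1 := hβ _ hx.symm
          have h2 := hβ _ hy.symm
          rw [extend_x] at h1
          rw [extend_y] at h2
          exact hξ (h1.trans h2.symm)
      obtain ⟨v, hx, hy, hv⟩ := hnone i hsi β
      exact hv (hβ v hx hy)
    · have e := hsome i t hsi
      have e0 : χ (D.px i 0) = t := e _ _ _
      have e1 : χ (D.px i 1) = t := e _ _ _
      have e2 : χ (D.py i 0) = t := e _ _ _
      have e3 : χ (D.py i 1) = t := e _ _ _
      rw [e0, e1, e2, e3]
      simp only [tileBase, tileCut]
      omega
  have htot : cutDegree D.graph χ = ∑ i, (D.innerCut i χ +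
      2 * (bdist (χ (D.px i 0)) (χ (.a (i - 1))) + bdist (χ (D.px i 1)) (χ (.b (i - 1))) +
        bdist (χ (D.py i 0)) (χ (.a (i + 1))) + bdist (χ (D.py i 1)) (χ (.b (i + 1))))) +
      2 * ∑ i, (bdist (χ (.c i)) (χ (.a i)) + bdist (χ (.c i)) (χ (.b i)) +
        bdist (χ (.c i)) (χ .u)) := by
    rw [cutDegree, D.sum_vertex, Finset.sum_congr rfl fun i _ => D.sum_cutRow_old hG i χ]
    simp only [(D.hasNeighbors_a _).cutRow, (D.hasNeighbors_b _).cutRow, (D.hasNeighbors_c _).cutRow,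
      D.hasNeighbors_u.cutRow, Fin.sum_univ_three, Fin.reduceSub, Fin.reduceAdd, Fin.isValue,
      zero_add, sub_self]
    simp only [bdist_comm (χ (.a _)), bdist_comm (χ (.b _)) (χ (D.px _ _)),
      bdist_comm (χ (.b _)) (χ (D.py _ _)), bdist_comm (χ (.b _)) (χ (.c _)),
      bdist_comm (χ .u)]
    omega
  have hlt : ∑ i, (tileBase (s i) + hubCut (s (i + 1)) (s (i - 1)) (χ .u) (χ (.a i)) (χ (.b i))
      (χ (.c i))) < 4 := by
    have t0 := tile 0
    have t1 := tile 1
    have t2 := tile 2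
    rw [htot] at hχ
    simp only [hubCut, Fin.sum_univ_three, Fin.reduceSub, Fin.reduceAdd, Fin.isValue,
      zero_add, sub_self] at t0 t1 t2 hχ ⊢
    omega
  obtain ⟨β, ⟨hsβ, hcen⟩ | ⟨j, hj, hsβ, hu, hcen⟩⟩ := windmill_cut_arith s _ _ _ _ hlt
  · have hold : ∀ i v hx hy, χ (.old i v hx hy) = β := fun i => hsome i β (hsβ i)
    rcases hcen with hcen | ⟨hu, j, hcen, hj⟩
    · refine ⟨.u, β, fun v hv => ?_⟩
      cases v with
      | old i v hx hy => exact hold _ _ _ _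
      | a i => exact (hcen i).1
      | b i => exact (hcen i).2.1
      | c i => exact (hcen i).2.2
      | u => exact absurd rfl hv
    · have fin : ∀ z : D.Vertex, (∀ v, v ≠ z → v = .a j ∨ v = .b j ∨ v = .c j → χ v = β) →
          ∀ v, v ≠ z → χ v = β := by
        intro z hz v hv
        cases v with
        | old i v hx hy => exact hold _ _ _ _
        | a i =>
          by_cases hi : i = j
          · subst hi; exact hz _ hv (by simp)
          · exact (hcen i hi).1
        | b i =>
          by_cases hi : i = j
          · subst hi; exact hz _ hv (by simp)
          · exact (hcen i hi).2.1
        | c i =>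
          by_cases hi : i = j
          · subst hi; exact hz _ hv (by simp)
          · exact (hcen i hi).2.2
        | u => exact hu
      rcases hj with h | h | h
      · exact ⟨.a j, β, fin _ fun v hv hv' => by grind⟩
      · exact ⟨.b j, β, fin _ fun v hv hv' => by grind⟩
      · exact ⟨.c j, β, fin _ fun v hv hv' => by grind⟩
  -- Everything outside tile `j`, except possibly nothing, has colour `β`; with `x_j`, `y_j` also
  -- coloured `β`, the cut of `G` is no larger than the given one.
  · have hle : cutDegree G (D.extend j χ β β) < 8 := by
      refine lt_of_le_of_lt ?_ hχ
      rw [htot, cutDegree_extend]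
      refine le_trans ?_ (Nat.le_add_right _ _)
      refine le_trans ?_ (Finset.single_le_sum (fun _ _ => Nat.zero_le _) (Finset.mem_univ j))
      simp [(hcen _).1, (hcen _).2.1, bdist]
    obtain ⟨z, β', hz⟩ := h _ hle
    have hβ : β' = β := by
      by_cases hxz : D.x j = z
      · have := hz (D.y j) (by rw [← hxz]; exact (D.x_ne_y j).symm)
        rwa [extend_y, eq_comm] at this
      · have := hz _ hxz
        rwa [extend_x, eq_comm] at this
    subst hβ
    have fin : ∀ z' : D.Vertex, (∀ v hx hy, .old j v hx hy ≠ z' → v ≠ z) → ∀ v, v ≠ z' → χ v = β' := by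
      intro z' hz' v hv
      cases v with
      | old i v hx hy =>
        by_cases hi : i = j
        · subst hi
          rw [← hz v (hz' v hx hy hv), D.extend_old]
        · exact hsome i _ (hsβ i hi) _ _ _
      | a i => exact (hcen i).1
      | b i => exact (hcen i).2.1
      | c i => exact (hcen i).2.2
      | u => exact hu
    by_cases hz0 : z ≠ D.x j ∧ z ≠ D.y j
    · refine ⟨.old j z hz0.1 hz0.2, β', fin _ ?_⟩
      rintro v hx hy hne rfl
      exact hne rfl
    -- The exceptional vertex was deleted, so the colouring is constant and `u` is an arbitrary
    -- witness.
    · refine ⟨.u, β', fin _ ?_⟩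
      rintro v hx hy - rfl
      exact hz0 ⟨hx, hy⟩

end WindmillData

/-! ### Assembly. -/

theorem theorem15
    -- `D.graph` is the 34-vertex graph, obtained from three copies of the Petersen graph
    (D : WindmillData petersenGraph)
    -- `E.graph` is obtained from three copies of the graph `D.graph`
    (E : WindmillData D.graph)
    -- the edge removed in each copy joins some `c_j` to `a_j` or `b_j`
    (hE : ∀ i, ∃ j : Fin 3,
      s(E.x i, E.y i) = s(WindmillData.Vertex.c j, WindmillData.Vertex.a j) ∨
      s(E.x i, E.y i) = s(WindmillData.Vertex.c j, WindmillData.Vertex.b j))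
    -- the three copies are not all inserted with the same orientation
    (hx : ∃ i j, E.x i = WindmillData.Vertex.c j)
    (hy : ∃ i j, E.y i = WindmillData.Vertex.c j) :
    Nat.card D.Vertex = 34 ∧ Nat.card E.Vertex = 106 ∧ IsSnark E.graph ∧
    ∀ C : Multiset E.graph.Subgraph, IsCycleCover E.graph C →
      (4 / 3 : ℚ) * (E.graph.edgeSet.ncard : ℚ) + 2 ≤ (coverLength C : ℚ) := by
  have := Fintype.ofFinite D.Vertex
  have := Fintype.ofFinite E.Vertex
  have hD : Nat.card D.Vertex = 34 := D.natCard_vertex 8 (by simp)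
  have hE' : Nat.card E.Vertex = 106 := E.natCard_vertex 32 hD
  have cubicD := D.graph_isCubic petersen_isCubic
  have cubicE := E.graph_isCubic cubicD
  have tightD := D.graph_noTightLabeling petersen_isCubic petersen_noTightLabeling
  have tightE := E.graph_noTightLabeling cubicD tightD
  have girthE := E.graph_noShortCycles (D.graph_noShortCycles petersen_noShortCycles)
  have connE := E.graph_isEssentiallyFourConnected cubicD
    (D.graph_isEssentiallyFourConnected petersen_isCubic petersen_isEssentiallyFourConnected)
  refine ⟨hD, hE', ⟨inferInstance, connE.connected cubicE, fun v => ?_, girthE.five_le_egirth,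
    connE.isCyclicallyEdgeConnected, tightE.not_colorable cubicE⟩, fun C hC => ?_⟩
  · obtain ⟨p, q, r, h⟩ := cubicE v
    exact h.ncard
  · have hlen := cubicE.le_coverLength (fun ℓ hs he z => WindmillData.not_tight_off_one_vertex
      E petersen_isCubic
      petersen_noTightLabeling hE hx hy hs he z) hC
    have hedge := cubicE.two_mul_ncard_edgeSet
    rw [Nat.card_eq_fintype_card] at hE'
    rw [hE'] at hlen hedge
    -- With 106 vertices there are 159 edges, and 2·106 + 2 = 214 = 4/3·159 + 2.
    have h1 : E.graph.edgeSet.ncard = 159 := by omega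
    have h2 : (214 : ℚ) ≤ coverLength C := by exact_mod_cast hlen
    rw [h1]
    norm_num
    linarith
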